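/- Let $d\ge 2$ be an integer, $\Lambda,L>0$, and $A(z)=-\tfrac12\Lambda^2z^2+\log(L/z)$ for $z>0$. For a squared momentum $p^2$, a tensor response function is a solution $E$ on $z>0$ of the Riccati equation $$E'-e^{A}E^2+dA'E+p^2e^{-A}=0 ,$$ and it is infrared (IR) regular if $-\int_{z_0}^{z}e^{A(z')}E(z')\,dz'$ is bounded above as $z\to\infty$ for some $z_0>0$ (i.e. the corresponding fluctuation stays bounded). Put $w=\Lambda z$, $\mathbf E(w)=L\,E\,e^{-\Lambda^2z^2/2}$, $a=\dfrac{p^2}{2(d-1)\Lambda^2}$, and let $U$ be Tricomi's confluent hypergeometric function, defined for all complex values of its first parameter by analytic continuation of $U(a,b,x)=\Gamma(a)^{-1}\int_0^\infty e^{-xt}t^{a-1}(1+t)^{b-a-1}\,dt$, $\operatorname{Re}a>0$, $x>0$. Write $U(w)=U\big(a,1-\tfrac d2,\tfrac{d-1}{2}w^2\big)$. (1) For every real $p^2\ge 0$ there is exactly one IR-regular tensor response function; $U(w)\neq0$ for all $w>0$, and $$\mathbf E(w)=-\frac{w\,\partial_wU(w)}{U(w)} .$$ (2) For every complex $p^2$,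 $U(w)$ is differentiable on $w>0$, and $\mathbf E:=-w\,\partial_wU/U$ satisfies, wherever $U(w)\ne0$, the equation $w\,\partial_w\mathbf E-\mathbf E^2-\big(d+(d-1)w^2\big)\mathbf E+\frac{p^2}{\Lambda^2}w^2=0$. (3) Let $d$ be even, and let $\mathcal S=\{-2(d-1)\Lambda^2m:\ m\in\mathbb Z,\ m\ge d/2\}$. Then there are real polynomials $c_k$ ($1\le k<d/2$), $\ell$, $Q$ in $p^2$ (with coefficients depending only on $d,\Lambda$) such that for every complex $p^2\notin\mathcal S$ one has $U(w)\ne0$ for all small $w>0$ and, as $w\to0^+$, $$-\frac{w\,\partial_wU}{U}=\sum_{1\le k<d/2}c_k(p^2)\,w^{2k}+\Big(\ell(p^2)\log w^2+\hat E_{(d)}(p^2)+Q(p^2)\Big)w^d+o(w^d),$$ where $$\hat E_{(d)}=\frac{2(-1)^{d/2}\left(\frac{d-1}{2}\right)^{d/2}\Gamma\left(\frac d2+a\right)}{\Gamma\left(\frac d2\right)^2\,\Gamma(a)}\;\psi\!\left(\frac d2+a\right),\qquad \psi=\Gamma'/\Gamma .$$ That is, up to contact terms (polynomials in $p^2$),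 the renormalized response function, i.e. the coefficient of $w^d$, equals $\hat E_{(d)}$. (4) For even $d$ the spin-2 spectrum is linear: $\hat E_{(d)}$ is meromorphic in $p^2\in\mathbb C$. Let $G$ be any meromorphic function of $p^2\in\mathbb C$ for which an expansion as in (3), with $G$ in place of $\hat E_{(d)}$ and with some real polynomials $c_k,\ell,Q$, holds for all real $p^2\ge0$. Then the set of poles of $G$ is exactly $$p^2=-2(d-1)\Lambda^2\,m,\qquad m=\tfrac d2,\tfrac d2+1,\tfrac d2+2,\dots,$$ and all of these poles are simple. -/

import Mathlib

open Set Filter Topology Asymptotics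

/-- Tricomi's integral `Γ(a)⁻¹ ∫₀^∞ e^{-xt} t^{a-1} (1+t)^{b-a-1} dt`, equal to `U(a,b,x)` for
`Re a > 0`, `x > 0`. -/
noncomputable def tricomiIntegral (a b : ℂ) (x : ℝ) : ℂ :=
  (Complex.Gamma a)⁻¹ *
    ∫ t in Ioi (0 : ℝ), Complex.exp (-(x * t : ℝ)) * (t : ℂ) ^ (a - 1) *
      ((1 + t : ℝ) : ℂ) ^ (b - a - 1)

/-- Continuation of Tricomi's integral from `Re a > 0` to `Re a > -N` by the contiguous relation
`U(a,b,x) = (x + 2(a+1) - b) U(a+1,b,x) - (a+1)(a-b+2) U(a+2,b,x)`. -/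
noncomputable def tricomiAux (b : ℂ) (x : ℝ) : ℕ → ℂ → ℂ
  | 0, a => tricomiIntegral a b x
  | N + 1, a => (x + 2 * (a + 1) - b) * tricomiAux b x N (a + 1)
      - (a + 1) * (a - b + 2) * tricomiAux b x N (a + 2)

/-- Tricomi's confluent hypergeometric function (Kummer's function of the second kind)
`U(a,b,x)` for complex parameters `a`, `b` and `x > 0`: Tricomi's integral for `Re a > 0`, and its
analytic continuation in `a` otherwise (compare the construction of `Complex.Gamma`). -/
noncomputable def tricomiU (a b : ℂ) (x : ℝ) : ℂ := tricomiAux b x ⌊1 - a.re⌋₊ a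

/-- The warp factor `A(z) = -Λ² z² / 2 + log (L / z)` in the conformal radial coordinate `z > 0`. -/
noncomputable def warpFactor (Λ L z : ℝ) : ℝ := -(Λ ^ 2 * z ^ 2) / 2 + Real.log (L / z)

/-- `E` is a tensor response function at squared momentum `p²` on the domain wall with warp factor
`A`: it solves `E' - e^A E² + d A' E + p² e^{-A} = 0` on `z > 0`. -/
def IsTensorResponse (d : ℕ) (A : ℝ → ℝ) (psq : ℝ) (E : ℝ → ℝ) : Prop :=
  ∀ z : ℝ, 0 < z → HasDerivAt E
    (Real.exp (A z) * E z ^ 2 - d * deriv A z * E z - psq * Real.exp (-A z)) z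

/-- Infrared regularity `-∫^z e^{A} E dz' < ∞` as `z → ∞`. Since `-∫^z e^A E` is the logarithm of the
fluctuation whose response function is `E`, it says that the fluctuation stays bounded. -/
def IsIRRegular (A E : ℝ → ℝ) : Prop :=
  ∃ z₀ : ℝ, 0 < z₀ ∧
    BddAbove ((fun z => -∫ t in z₀..z, Real.exp (A t) * E t) '' Ici z₀)

/-- The dimensionless response function `L E e^{-Λ² z² / 2}` as a function of `w = Λ z`. -/
noncomputable def dimlessResponse (Λ L : ℝ) (E : ℝ → ℝ) (w : ℝ) : ℝ :=
  L * E (w / Λ) * Real.exp (-(w ^ 2 / 2))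

/-- The parameter `p² / (2 (d - 1) Λ²)`. -/
noncomputable def momentumParam (d : ℕ) (Λ : ℝ) (psq : ℂ) : ℂ :=
  psq / (2 * ((d : ℂ) - 1) * (Λ : ℂ) ^ 2)

/-- `w ↦ U(p² / (2 (d - 1) Λ²), 1 - d/2, (d - 1) w² / 2)`. -/
noncomputable def tensorMode (d : ℕ) (Λ : ℝ) (psq : ℂ) (w : ℝ) : ℂ :=
  tricomiU (momentumParam d Λ psq) (1 - (d : ℂ) / 2) (((d : ℝ) - 1) / 2 * w ^ 2)

/-- `-w ∂_w U / U`, for complex squared momentum. -/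
noncomputable def tricomiResponse (d : ℕ) (Λ : ℝ) (psq : ℂ) (w : ℝ) : ℂ :=
  -(w * deriv (tensorMode d Λ psq) w) / tensorMode d Λ psq w

/-- For even `d`: `G` is, up to contact terms, the renormalized response function of the family `R` on
the set `D` of squared momenta. That is, as `w → 0⁺`,
`R(w) = ∑_{1 ≤ k < d/2} c_k(p²) w^{2k} + (ℓ(p²) log w² + G(p²) + Q(p²)) w^d + o(w^d)`,
with local coefficients `c_k`, `ℓ`, `Q`, i.e. polynomials in `p²`. -/
def IsNonanalyticRenormalizedPart (d : ℕ) (D : Set ℂ) (R : ℂ → ℝ → ℂ) (G : ℂ → ℂ) : Prop :=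
  ∃ (c : ℕ → Polynomial ℝ) (ℓ Q : Polynomial ℝ), ∀ s ∈ D,
    (fun w : ℝ => R s w
        - (∑ k ∈ Finset.Ico 1 (d / 2), Polynomial.aeval s (c k) * (w : ℂ) ^ (2 * k))
        - (Polynomial.aeval s ℓ * (Real.log (w ^ 2) : ℂ) + G s + Polynomial.aeval s Q) * (w : ℂ) ^ d)
      =o[𝓝[>] (0 : ℝ)] (fun w : ℝ => w ^ d)

/-- `2 (-1)^{d/2} ((d-1)/2)^{d/2} Γ(d/2 + a) ψ(d/2 + a) / (Γ(d/2)² Γ(a))`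
with `a = p² / (2 (d - 1) Λ²)`. -/
noncomputable def EhatFormula (d : ℕ) (Λ : ℝ) (psq : ℂ) : ℂ :=
  2 * (-1) ^ (d / 2) * (((d : ℂ) - 1) / 2) ^ (d / 2) *
      Complex.Gamma ((d : ℂ) / 2 + momentumParam d Λ psq) /
      (Complex.Gamma ((d : ℂ) / 2) ^ 2 * Complex.Gamma (momentumParam d Λ psq)) *
    Complex.digamma ((d : ℂ) / 2 + momentumParam d Λ psq)

/-- The set of values `p² = -2 (d - 1) Λ² m`, `m = d/2, d/2 + 1, …` (a linear spectrum of
masses squared `-p²`). -/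
def linearSpectrum (d : ℕ) (Λ : ℝ) : Set ℂ :=
  {s | ∃ m : ℕ, d / 2 ≤ m ∧ s = -(2 * ((d : ℂ) - 1) * (Λ : ℂ) ^ 2 * m)}

/-- The spectrum read off from a meromorphic response function of `p²`: the set of its poles. -/
def poleSpectrum (G : ℂ → ℂ) : Set ℂ := {s | meromorphicOrderAt G s < 0}

/-!
With `x = (d-1) w² / 2`, `b = 1 - d/2` and `a = p² / (2 (d-1) Λ²)`, the fluctuations of the domain
wall are governed by Kummer's equation, and `U(a, b, x)` is the solution that stays bounded in the
infrared.

*Tricomi's function for all `a`.* The continuation in `a` is defined by a contiguous relation, so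
every identity is checked for `Re a > 0` by integrating by parts in Tricomi's integral, and then
passes from `a + 1`, `a + 2` to `a` (`induction_of_re_pos`). The two identities that carry everything
else are `x U(a+1, b+1) = U(a, b) - (a-b+1) U(a+1, b)` and `∂_x U(a, b) = -a U(a+1, b+1)`
(`mul_tricomiU_add_one_add_one`, `hasDerivAt_tricomiU`). They give Kummer's equation
(`kummer_tricomiU`), which turns into the Riccati equation for `-w ∂_w U / U`
(`tricomiResponse_riccati`).

*Infrared regularity.* For `p² ≥ 0` Tricomi's integrand is positive, so `U > 0` and `∂_x U ≤ 0`; the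
response is nonnegative and hence regular. Conversely let `f = exp (-∫ e^A E)` be the fluctuation of
a regular response `E`. The momentum `e^{dA} E f` is antitone, and a negative value would make `f`
grow at least linearly; so `E ≥ 0`. For two regular responses `E`, `F` with fluctuations `f`, `g` the
Wronskian `e^{dA} (E - F) f g` is constant, and a nonzero value would drive one of the positive
functions `f`, `g` below zero in finite time (`IsTensorResponse.eqOn`).

*Expansion at the boundary.* Let `d = 2n`. The case `b = 1` is
`Γ(a) U(a, 1, x) = -log x - ψ(a) + C + o(1)`. For `Re a > 0` the dependence on `a` is
`∫₀^∞ (t^{a-1} (1+t)^{-a} - (1+t)^{-1}) dt = -γ - ψ(a)`, which is the derivative of a beta integral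
(`integral_digammaKernel`); the case `a = 1` is elementary, and the contiguous relation does the rest
(`exists_tendsto_tricomiU_one`). Since `∂_x U(a, -n, x) = -a U(a+1, 1-n, x)`, and since
`Γ(a+n) U(a, 1-n, x) → Γ(n)`, integrating `n` times gives the expansion of `U(a, 1-n, x)` to the order
`x^n` (`HasTricomiExpansion.succ`). After multiplication by `Γ(a+n)` all its coefficients are real
polynomials in `a`, except for a single `ψ(a+n)` next to `log x`. Dividing the expansion of `x ∂_x U`
by that of `U`, whose leading coefficient does not depend on `a`, keeps this form
(`isLittleO_quotient`), and the term with `ψ` is `EhatFormula` (`EhatFormula_eq`).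

*Spectrum.* The coefficient of `w^d` next to the logarithm is determined by the function, so a
competitor `G` differs from `EhatFormula` by a polynomial on `[0, ∞)`, hence everywhere by the
identity theorem. Thus `G` has the poles of `(a)_n ψ(a+n)`: those of `ψ(a+n)` are simple and lie at
`a = -n, -n-1, …`, where the Pochhammer polynomial `(a)_n` does not vanish.
-/

/-! ### The kernel `e^{-xt} t^α (1+t)^c` and its integral -/

/-- The integrand `e^{-xt} t^α (1+t)^c` of Tricomi's integral, with independent exponents. -/
noncomputable def tricomiKernel (α c : ℂ) (x t : ℝ) : ℂ :=
  Complex.exp (-(x * t : ℝ)) * (t : ℂ) ^ α * ((1 + t : ℝ) : ℂ) ^ c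

/-- The unnormalized Tricomi integral `∫₀^∞ e^{-xt} t^α (1+t)^c dt`. -/
noncomputable def tricomiJ (α c : ℂ) (x : ℝ) : ℂ := ∫ t in Ioi (0 : ℝ), tricomiKernel α c x t

lemma tricomiIntegral_eq (a b : ℂ) (x : ℝ) :
    tricomiIntegral a b x = (Complex.Gamma a)⁻¹ * tricomiJ (a - 1) (b - a - 1) x := rfl

lemma norm_tricomiKernel {α c : ℂ} {x t : ℝ} (ht : 0 < t) :
    ‖tricomiKernel α c x t‖ = Real.exp (-(x * t)) * t ^ α.re * (1 + t) ^ c.re := by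
  unfold tricomiKernel
  rw [norm_mul, norm_mul, Complex.norm_cpow_eq_rpow_re_of_pos ht,
    Complex.norm_cpow_eq_rpow_re_of_pos (by linarith), Complex.norm_exp]
  simp

lemma one_add_rpow_le_exp (r : ℝ) {δ : ℝ} (hδ : 0 < δ) :
    ∃ C : ℝ, 0 < C ∧ ∀ t : ℝ, 0 ≤ t → (1 + t) ^ r ≤ C * Real.exp (δ * t) := by
  set N := ⌈r⌉₊
  refine ⟨N.factorial * Real.exp δ / δ ^ N, by positivity, fun t ht => ?_⟩
  have h1 : (1 + t) ^ r ≤ (1 + t) ^ N := by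
    rw [← Real.rpow_natCast]
    exact Real.rpow_le_rpow_of_exponent_le (by linarith) (Nat.le_ceil r)
  refine h1.trans ?_
  have h2 := Real.pow_div_factorial_le_exp (δ * (1 + t)) (by positivity) N
  rw [div_le_iff₀ (by positivity), mul_pow, mul_add, Real.exp_add, mul_one] at h2
  rw [div_mul_eq_mul_div, le_div_iff₀ (by positivity)]
  nlinarith [h2]

lemma integrableOn_rpow_mul_exp {s x : ℝ} (hs : -1 < s) (hx : 0 < x) :
    MeasureTheory.IntegrableOn (fun t : ℝ => t ^ s * Real.exp (-(x * t))) (Ioi 0) := by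
  have := integrableOn_rpow_mul_exp_neg_mul_rpow (p := 1) hs one_pos hx
  simpa [neg_mul] using this

lemma continuousOn_tricomiKernel (α c : ℂ) (x : ℝ) :
    ContinuousOn (tricomiKernel α c x) (Ioi 0) := by
  unfold tricomiKernel
  refine ContinuousOn.mul (ContinuousOn.mul (by fun_prop) ?_) ?_
  · exact ContinuousOn.cpow_const (by fun_prop) fun t ht => Or.inl (by simpa using ht)
  · exact ContinuousOn.cpow_const (by fun_prop) fun t ht => Or.inl (by
      have : (0 : ℝ) < t := ht
      simp only [Complex.ofReal_re]; linarith)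

/-- An integrable bound for the kernel, locally uniform in `x`. -/
lemma exists_tricomiKernel_bound (α c : ℂ) {δ : ℝ} (hδ : 0 < δ) :
    ∃ C : ℝ, 0 < C ∧ ∀ x t : ℝ, 2 * δ ≤ x → 0 < t →
      ‖tricomiKernel α c x t‖ ≤ C * (t ^ α.re * Real.exp (-(δ * t))) := by
  obtain ⟨C, hC, h⟩ := one_add_rpow_le_exp c.re hδ
  refine ⟨C, hC, fun x t hx ht => ?_⟩
  rw [norm_tricomiKernel ht]
  have h1 := h t ht.le
  have h2 : Real.exp (-(x * t)) ≤ Real.exp (-(δ * t)) * Real.exp (-(δ * t)) := by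
    rw [← Real.exp_add]; apply Real.exp_le_exp.2; nlinarith
  calc Real.exp (-(x * t)) * t ^ α.re * (1 + t) ^ c.re
      ≤ (Real.exp (-(δ * t)) * Real.exp (-(δ * t))) * t ^ α.re * (C * Real.exp (δ * t)) := by
        gcongr
    _ = C * (t ^ α.re * Real.exp (-(δ * t))) * (Real.exp (-(δ * t)) * Real.exp (δ * t)) := by ring
    _ = _ := by rw [← Real.exp_add]; simp

lemma integrableOn_tricomiKernel {α : ℂ} (c : ℂ) {x : ℝ} (hα : -1 < α.re) (hx : 0 < x) :
    MeasureTheory.IntegrableOn (tricomiKernel α c x) (Ioi 0) := by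
  obtain ⟨C, -, h⟩ := exists_tricomiKernel_bound α c (δ := x / 2) (by linarith)
  refine MeasureTheory.Integrable.mono'
    ((integrableOn_rpow_mul_exp hα (x := x / 2) (by linarith)).const_mul C)
    ((continuousOn_tricomiKernel α c x).aestronglyMeasurable measurableSet_Ioi) ?_
  filter_upwards [MeasureTheory.ae_restrict_mem measurableSet_Ioi] with t ht
  exact h x t (by linarith) ht

lemma tricomiKernel_add_one_right (α c : ℂ) (x : ℝ) {t : ℝ} (ht : 0 < t) :
    tricomiKernel α (c + 1) x t = tricomiKernel α c x t + tricomiKernel (α + 1) c x t := by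
  unfold tricomiKernel
  have h1 : (t : ℂ) ≠ 0 := by exact_mod_cast ht.ne'
  have h2 : ((1 + t : ℝ) : ℂ) ≠ 0 := by exact_mod_cast (by linarith : (1 + t) ≠ 0)
  rw [Complex.cpow_add _ _ h1, Complex.cpow_add _ _ h2]
  simp only [Complex.cpow_one]
  push_cast
  ring

lemma tricomiJ_add_one_right {α : ℂ} (c : ℂ) {x : ℝ} (hα : -1 < α.re) (hx : 0 < x) :
    tricomiJ α (c + 1) x = tricomiJ α c x + tricomiJ (α + 1) c x := by
  unfold tricomiJ
  rw [← MeasureTheory.integral_add (integrableOn_tricomiKernel c hα hx)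
    (integrableOn_tricomiKernel c (by simp; linarith) hx)]
  exact MeasureTheory.setIntegral_congr_fun measurableSet_Ioi
    fun t ht => tricomiKernel_add_one_right α c x ht

lemma hasDerivAt_ofReal_cpow {t : ℝ} (ht : 0 < t) (α : ℂ) :
    HasDerivAt (fun t : ℝ => (t : ℂ) ^ (α + 1)) ((α + 1) * (t : ℂ) ^ α) t := by
  have := ((hasDerivAt_id (t : ℂ)).cpow_const (c := α + 1) (Or.inl (by simpa using ht))).comp_ofReal
  simpa using this

lemma hasDerivAt_tricomiKernel_right (α c : ℂ) (x : ℝ) {t : ℝ} (ht : 0 < t) :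
    HasDerivAt (tricomiKernel (α + 1) c x)
      (-x * tricomiKernel (α + 1) c x t + (α + 1) * tricomiKernel α c x t
        + c * tricomiKernel (α + 1) (c - 1) x t) t := by
  unfold tricomiKernel
  have h1 : HasDerivAt (fun t : ℝ => Complex.exp (-(x * t : ℝ)))
      (Complex.exp (-(x * t : ℝ)) * (-x)) t := by
    have : HasDerivAt (fun t : ℝ => (-(x * t : ℝ) : ℂ)) (-x) t := by
      have := (((hasDerivAt_id t).const_mul x).ofReal_comp).fun_neg
      simpa using this
    exact this.cexp
  have h2 := hasDerivAt_ofReal_cpow ht α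
  have h3 : HasDerivAt (fun t : ℝ => ((1 + t : ℝ) : ℂ) ^ c) (c * ((1 + t : ℝ) : ℂ) ^ (c - 1)) t := by
    have := (hasDerivAt_ofReal_cpow (t := 1 + t) (by linarith) (c - 1)).comp_const_add 1 t
    simpa using this
  convert! (h1.fun_mul h2).fun_mul h3 using 1
  ring

lemma tendsto_tricomiKernel_nhds_zero {α : ℂ} (c : ℂ) (x : ℝ) (hα : 0 < α.re) :
    Tendsto (tricomiKernel α c x) (𝓝[>] 0) (𝓝 0) := by
  rw [tendsto_zero_iff_norm_tendsto_zero]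
  have h : Tendsto (fun t : ℝ => Real.exp (-(x * t)) * t ^ α.re * (1 + t) ^ c.re) (𝓝 0) (𝓝 0) := by
    have : ContinuousAt (fun t : ℝ => Real.exp (-(x * t)) * t ^ α.re * (1 + t) ^ c.re) 0 := by
      refine ContinuousAt.mul (ContinuousAt.mul (by fun_prop) ?_) ?_
      · exact Real.continuousAt_rpow_const _ _ (Or.inr hα.le)
      · exact ContinuousAt.rpow_const (by fun_prop) (Or.inl (by norm_num))
    simpa [ContinuousAt, Real.zero_rpow hα.ne'] using this
  refine (h.mono_left nhdsWithin_le_nhds).congr' ?_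
  filter_upwards [self_mem_nhdsWithin] with t ht
  exact (norm_tricomiKernel ht).symm

lemma tendsto_tricomiKernel_atTop (α c : ℂ) {x : ℝ} (hx : 0 < x) :
    Tendsto (tricomiKernel α c x) atTop (𝓝 0) := by
  obtain ⟨C, hC, h⟩ := exists_tricomiKernel_bound α c (δ := x / 2) (by linarith)
  have h0 : Tendsto (fun t : ℝ => C * (t ^ α.re * Real.exp (-(x / 2 * t)))) atTop (𝓝 0) := by
    have := (tendsto_rpow_mul_exp_neg_mul_atTop_nhds_zero α.re (x / 2) (by linarith)).const_mul C
    simpa [neg_mul] using this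
  refine squeeze_zero_norm' ?_ h0
  filter_upwards [eventually_gt_atTop 0] with t ht
  exact h x t (by linarith) ht

/-- Integration by parts in Tricomi's integral. -/
lemma tricomiJ_by_parts {α : ℂ} (c : ℂ) {x : ℝ} (hα : -1 < α.re) (hx : 0 < x) :
    -x * tricomiJ (α + 1) c x + (α + 1) * tricomiJ α c x + c * tricomiJ (α + 1) (c - 1) x = 0 := by
  have hα' : -1 < (α + 1).re := by simp; linarith
  have i1 := (integrableOn_tricomiKernel c hα' hx).const_mul (-x : ℂ)
  have i2 := (integrableOn_tricomiKernel c hα hx).const_mul (α + 1)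
  have i3 := (integrableOn_tricomiKernel (c - 1) hα' hx).const_mul c
  have i12 : MeasureTheory.IntegrableOn (fun t => -x * tricomiKernel (α + 1) c x t
      + (α + 1) * tricomiKernel α c x t) (Ioi 0) := i1.add i2
  have h0 : tricomiKernel (α + 1) c x 0 = 0 := by
    have : α + 1 ≠ 0 := fun h => by simp [Complex.ext_iff] at h; linarith
    simp [tricomiKernel, Complex.zero_cpow this]
  have hcont : ContinuousWithinAt (tricomiKernel (α + 1) c x) (Ici 0) 0 := by
    rw [← continuousWithinAt_Ioi_iff_Ici, ContinuousWithinAt, h0]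
    exact tendsto_tricomiKernel_nhds_zero c x (by simp; linarith)
  have key := MeasureTheory.integral_Ioi_of_hasDerivAt_of_tendsto hcont
    (fun t ht => hasDerivAt_tricomiKernel_right α c x ht) (i12.add i3)
    (tendsto_tricomiKernel_atTop _ c hx)
  rw [h0] at key
  rw [MeasureTheory.integral_add i12 i3, MeasureTheory.integral_add i1 i2,
    MeasureTheory.integral_const_mul, MeasureTheory.integral_const_mul,
    MeasureTheory.integral_const_mul, sub_zero] at key
  exact key

lemma hasDerivAt_tricomiKernel_left (α c : ℂ) (x : ℝ) {t : ℝ} (ht : 0 < t) :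
    HasDerivAt (fun x => tricomiKernel α c x t) (-tricomiKernel (α + 1) c x t) x := by
  unfold tricomiKernel
  have h0 : HasDerivAt (fun x : ℝ => (-(x * t : ℝ) : ℂ)) (-t) x := by
    have := (((hasDerivAt_id x).mul_const t).ofReal_comp).fun_neg
    simpa using this
  have h1 : (t : ℂ) ≠ 0 := by exact_mod_cast ht.ne'
  convert! (h0.cexp.mul_const ((t : ℂ) ^ α)).mul_const (((1 + t : ℝ) : ℂ) ^ c) using 1
  rw [Complex.cpow_add _ _ h1, Complex.cpow_one]
  ring

lemma hasDerivAt_tricomiJ {α : ℂ} (c : ℂ) {x : ℝ} (hα : -1 < α.re) (hx : 0 < x) :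
    HasDerivAt (tricomiJ α c) (-tricomiJ (α + 1) c x) x := by
  have hα' : -1 < (α + 1).re := by simp; linarith
  obtain ⟨C, -, h⟩ := exists_tricomiKernel_bound (α + 1) c (δ := x / 4) (by linarith)
  have key := hasDerivAt_integral_of_dominated_loc_of_deriv_le
    (μ := MeasureTheory.volume.restrict (Ioi (0 : ℝ)))
    (F := fun x t => tricomiKernel α c x t) (F' := fun x t => -tricomiKernel (α + 1) c x t)
    (x₀ := x) (s := Ioi (x / 2)) (bound := fun t => C * (t ^ (α + 1).re * Real.exp (-(x / 4 * t))))
    (Ioi_mem_nhds (by linarith))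
    (Eventually.of_forall fun y =>
      (continuousOn_tricomiKernel α c y).aestronglyMeasurable measurableSet_Ioi)
    (integrableOn_tricomiKernel c hα hx)
    ((continuousOn_tricomiKernel (α + 1) c x).neg.aestronglyMeasurable measurableSet_Ioi) ?_
    ((integrableOn_rpow_mul_exp hα' (x := x / 4) (by linarith)).const_mul C) ?_
  · have := key.2
    rw [MeasureTheory.integral_neg] at this
    exact this
  · filter_upwards [MeasureTheory.ae_restrict_mem measurableSet_Ioi] with t ht y hy
    rw [norm_neg]
    exact h y t (by have : x / 2 < y := hy; linarith) ht
  · filter_upwards [MeasureTheory.ae_restrict_mem measurableSet_Ioi] with t ht y hy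
    exact hasDerivAt_tricomiKernel_left α c y ht

/-! ### Contiguous relations for Tricomi's function -/

/-- A property of the first parameter that holds in the right half plane, and that passes from
`a + 1` and `a + 2` to `a`, holds everywhere. -/
lemma induction_of_re_pos {P : ℂ → Prop} (h₀ : ∀ a : ℂ, 0 < a.re → P a)
    (h : ∀ a : ℂ, P (a + 1) → P (a + 2) → P a) (a : ℂ) : P a := by
  have key : ∀ (N : ℕ) (a : ℂ), -(N : ℝ) < a.re → P a := by
    intro N
    induction N with
    | zero => intro a ha; exact h₀ a (by simpa using ha)
    | succ N ih =>
      intro a ha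
      push_cast at ha
      exact h a (ih _ (by simp; linarith)) (ih _ (by simp; linarith))
  obtain ⟨N, hN⟩ := exists_nat_gt (-a.re)
  exact key N a (by linarith)

section Integral

variable {a : ℂ} (b : ℂ) {x : ℝ}

lemma ne_zero_of_re_pos (ha : 0 < a.re) : a ≠ 0 := fun h => by simp [h] at ha

lemma tricomiIntegral_add_one_left (ha : 0 < a.re) :
    tricomiIntegral (a + 1) b x = (a * Complex.Gamma a)⁻¹ * tricomiJ a (b - a - 2) x := by
  rw [tricomiIntegral_eq, Complex.Gamma_add_one _ (ne_zero_of_re_pos ha)]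
  congr 2 <;> ring

lemma tricomiIntegral_add_one_add_one (ha : 0 < a.re) :
    tricomiIntegral (a + 1) (b + 1) x = (a * Complex.Gamma a)⁻¹ * tricomiJ a (b - a - 1) x := by
  rw [tricomiIntegral_eq, Complex.Gamma_add_one _ (ne_zero_of_re_pos ha)]
  congr 2 <;> ring

lemma tricomiIntegral_add_two_left (ha : 0 < a.re) :
    tricomiIntegral (a + 2) b x =
      ((a + 1) * (a * Complex.Gamma a))⁻¹ * tricomiJ (a + 1) (b - a - 3) x := by
  have h : a + 1 ≠ 0 := ne_zero_of_re_pos (by simp; linarith)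
  rw [tricomiIntegral_eq, show a + 2 = (a + 1) + 1 by ring, Complex.Gamma_add_one _ h,
    Complex.Gamma_add_one _ (ne_zero_of_re_pos ha)]
  congr 2 <;> ring

lemma tricomiIntegral_contiguous (ha : 0 < a.re) (hx : 0 < x) :
    tricomiIntegral a b x = (x + 2 * (a + 1) - b) * tricomiIntegral (a + 1) b x
      - (a + 1) * (a - b + 2) * tricomiIntegral (a + 2) b x := by
  rw [tricomiIntegral_add_one_left b ha, tricomiIntegral_add_two_left b ha, tricomiIntegral_eq]
  have hG := Complex.Gamma_ne_zero_of_re_pos ha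
  have h0 := ne_zero_of_re_pos ha
  have h1 : a + 1 ≠ 0 := ne_zero_of_re_pos (by simp; linarith)
  have e1 := tricomiJ_by_parts (α := a - 1) (b - a - 2) (by simp; linarith) hx
  have e2 := tricomiJ_add_one_right (α := a - 1) (b - a - 2) (by simp; linarith) hx
  have e3 := tricomiJ_add_one_right (α := a) (b - a - 3) (by linarith) hx
  rw [show a - 1 + 1 = a by ring] at e1 e2
  rw [show b - a - 2 - 1 = b - a - 3 by ring] at e1
  rw [show b - a - 2 + 1 = b - a - 1 by ring] at e2
  rw [show b - a - 3 + 1 = b - a - 2 by ring] at e3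
  field_simp
  rw [e2]
  linear_combination e1 + (b - a - 2) * e3

lemma mul_tricomiIntegral_add_one_add_one (ha : 0 < a.re) (hx : 0 < x) :
    x * tricomiIntegral (a + 1) (b + 1) x =
      tricomiIntegral a b x - (a - b + 1) * tricomiIntegral (a + 1) b x := by
  rw [tricomiIntegral_add_one_left b ha, tricomiIntegral_add_one_add_one b ha, tricomiIntegral_eq]
  have hG := Complex.Gamma_ne_zero_of_re_pos ha
  have h0 := ne_zero_of_re_pos ha
  have e1 := tricomiJ_by_parts (α := a - 1) (b - a - 1) (by simp; linarith) hx
  rw [show a - 1 + 1 = a by ring, show b - a - 1 - 1 = b - a - 2 by ring] at e1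
  field_simp
  linear_combination -e1

lemma hasDerivAt_tricomiIntegral (ha : 0 < a.re) (hx : 0 < x) :
    HasDerivAt (tricomiIntegral a b) (-a * tricomiIntegral (a + 1) (b + 1) x) x := by
  have h0 := ne_zero_of_re_pos ha
  have hG := Complex.Gamma_ne_zero_of_re_pos ha
  have := (hasDerivAt_tricomiJ (α := a - 1) (b - a - 1) (by simp; linarith) hx).const_mul
    (Complex.Gamma a)⁻¹
  rw [show a - 1 + 1 = a by ring] at this
  rw [tricomiIntegral_add_one_add_one b ha]
  convert! this using 1
  field_simp

end Integral

/-- The continuations over different half planes agree. -/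
lemma tricomiAux_succ (b : ℂ) {x : ℝ} (hx : 0 < x) (N : ℕ) :
    ∀ a : ℂ, -(N : ℝ) < a.re → tricomiAux b x (N + 1) a = tricomiAux b x N a := by
  induction N with
  | zero =>
    intro a ha
    simp only [tricomiAux]
    exact (tricomiIntegral_contiguous b (by simpa using ha) hx).symm
  | succ N ih =>
    intro a ha
    push_cast at ha
    rw [tricomiAux, ih (a + 1) (by simp; linarith), ih (a + 2) (by simp; linarith), ← tricomiAux]

lemma tricomiU_eq_tricomiAux (b : ℂ) {x : ℝ} (hx : 0 < x) {N : ℕ} {a : ℂ} (h : -(N : ℝ) < a.re) :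
    tricomiU a b x = tricomiAux b x N a := by
  have key : ∀ k M : ℕ, -(M : ℝ) < a.re → tricomiAux b x (M + k) a = tricomiAux b x M a := by
    intro k M hM
    induction k with
    | zero => rfl
    | succ k ih => rw [← ih, ← add_assoc, tricomiAux_succ b hx]; push_cast; linarith
  have h1 : -((⌊1 - a.re⌋₊ : ℕ) : ℝ) < a.re := by linarith [Nat.lt_floor_add_one (1 - a.re)]
  unfold tricomiU
  rcases le_total N ⌊1 - a.re⌋₊ with hN | hN
  · obtain ⟨k, hk⟩ := Nat.exists_eq_add_of_le hN
    rw [hk, key k N h]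
  · obtain ⟨k, hk⟩ := Nat.exists_eq_add_of_le hN
    rw [hk, key k _ h1]

lemma tricomiU_eq_tricomiIntegral (b : ℂ) {x : ℝ} (hx : 0 < x) {a : ℂ} (ha : 0 < a.re) :
    tricomiU a b x = tricomiIntegral a b x :=
  tricomiU_eq_tricomiAux b hx (N := 0) (by simpa using ha)

/-- The contiguous relation in the first parameter, for all complex parameters. -/
lemma tricomiU_contiguous (a b : ℂ) {x : ℝ} (hx : 0 < x) :
    tricomiU a b x = (x + 2 * (a + 1) - b) * tricomiU (a + 1) b x
      - (a + 1) * (a - b + 2) * tricomiU (a + 2) b x := by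
  have h1 : -((⌊1 - a.re⌋₊ : ℕ) : ℝ) < a.re := by linarith [Nat.lt_floor_add_one (1 - a.re)]
  set N := ⌊1 - a.re⌋₊
  rw [tricomiU_eq_tricomiAux b hx (N := N + 1) (a := a) (by push_cast; linarith),
    tricomiU_eq_tricomiAux b hx (N := N) (a := a + 1) (by simp; linarith),
    tricomiU_eq_tricomiAux b hx (N := N) (a := a + 2) (by simp; linarith), tricomiAux]

lemma mul_tricomiU_add_one_add_one (a b : ℂ) {x : ℝ} (hx : 0 < x) :
    x * tricomiU (a + 1) (b + 1) x = tricomiU a b x - (a - b + 1) * tricomiU (a + 1) b x := by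
  induction a using induction_of_re_pos with
  | h₀ a ha =>
    have ha1 : 0 < (a + 1).re := by simp; linarith
    rw [tricomiU_eq_tricomiIntegral _ hx ha, tricomiU_eq_tricomiIntegral _ hx ha1,
      tricomiU_eq_tricomiIntegral _ hx ha1]
    exact mul_tricomiIntegral_add_one_add_one b ha hx
  | h a h1 h2 =>
    have e1 := tricomiU_contiguous (a + 1) (b + 1) hx
    have e2 := tricomiU_contiguous (a + 1) b hx
    have e3 := tricomiU_contiguous a b hx
    have r1 : a + 2 + 1 = a + 1 + 2 := by ring
    have r2 : a + 1 + 1 = a + 2 := by ring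
    rw [r1] at h2
    rw [r2] at h1 e1 e2
    linear_combination x * e1 + (x + 2 * (a + 2) - (b + 1)) * h1
      - (a + 2) * (a - b + 2) * h2 + (a - b + 2) * e2 - e3

lemma tricomiU_add_one_right (a b : ℂ) {x : ℝ} (hx : 0 < x) :
    tricomiU (a + 1) (b + 1) x = tricomiU (a + 1) b x + (a + 1) * tricomiU (a + 2) (b + 1) x := by
  have hx' : (x : ℂ) ≠ 0 := by exact_mod_cast hx.ne'
  have x1 := mul_tricomiU_add_one_add_one (a + 1) b hx
  rw [show a + 1 + 1 = a + 2 by ring] at x1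
  refine mul_left_cancel₀ hx' ?_
  linear_combination mul_tricomiU_add_one_add_one a b hx + tricomiU_contiguous a b hx - (a + 1) * x1

/-- Differentiation in `x` raises both parameters. -/
lemma hasDerivAt_tricomiU (a b : ℂ) {x : ℝ} (hx : 0 < x) :
    HasDerivAt (tricomiU a b) (-a * tricomiU (a + 1) (b + 1) x) x := by
  induction a using induction_of_re_pos with
  | h₀ a ha =>
    have ha1 : 0 < (a + 1).re := by simp; linarith
    rw [tricomiU_eq_tricomiIntegral _ hx ha1]
    refine (hasDerivAt_tricomiIntegral b ha hx).congr_of_eventuallyEq ?_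
    filter_upwards [Ioi_mem_nhds hx] with y hy
    exact tricomiU_eq_tricomiIntegral b hy ha
  | h a h1 h2 =>
    have hlin : HasDerivAt (fun y : ℝ => (y + 2 * (a + 1) - b : ℂ)) 1 x := by
      have := (hasDerivAt_id x).ofReal_comp
      simpa using (this.add_const (2 * (a + 1))).sub_const b
    have h3 := (hlin.fun_mul h1).fun_sub (h2.const_mul ((a + 1) * (a - b + 2)))
    have h4 : HasDerivAt (tricomiU a b) _ x := h3.congr_of_eventuallyEq (by
      filter_upwards [Ioi_mem_nhds hx] with y hy
      exact tricomiU_contiguous a b hy)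
    convert! h4 using 1
    have e1 := tricomiU_contiguous (a + 1) (b + 1) hx
    have r1 : a + 2 + 1 = a + 1 + 2 := by ring
    have r2 : a + 1 + 1 = a + 2 := by ring
    rw [r1]
    rw [r2] at e1 ⊢
    have key := tricomiU_add_one_right a b hx
    linear_combination key - (a + 1) * e1

lemma hasDerivAt_tricomiKernel_zero_left (c : ℂ) (x : ℝ) {t : ℝ} (ht : -1 < t) :
    HasDerivAt (tricomiKernel 0 c x)
      (-x * tricomiKernel 0 c x t + c * tricomiKernel 0 (c - 1) x t) t := by
  unfold tricomiKernel
  simp only [Complex.cpow_zero, mul_one]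
  have h1 : HasDerivAt (fun t : ℝ => Complex.exp (-(x * t : ℝ)))
      (Complex.exp (-(x * t : ℝ)) * (-x)) t := by
    have : HasDerivAt (fun t : ℝ => (-(x * t : ℝ) : ℂ)) (-x) t := by
      have := (((hasDerivAt_id t).const_mul x).ofReal_comp).fun_neg
      simpa using this
    exact this.cexp
  have h3 : HasDerivAt (fun t : ℝ => ((1 + t : ℝ) : ℂ) ^ c) (c * ((1 + t : ℝ) : ℂ) ^ (c - 1)) t := by
    have := (hasDerivAt_ofReal_cpow (t := 1 + t) (by linarith) (c - 1)).comp_const_add 1 t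
    simpa using this
  convert! h1.fun_mul h3 using 1
  ring

/-- `U(0, b, x) = 1`. -/
lemma tricomiU_zero (b : ℂ) {x : ℝ} (hx : 0 < x) : tricomiU 0 b x = 1 := by
  have e0 := tricomiU_contiguous 0 b hx
  rw [tricomiU_eq_tricomiIntegral (a := 0 + 1) b hx (by simp),
    tricomiU_eq_tricomiIntegral (a := 0 + 2) b hx (by simp), tricomiIntegral_eq,
    tricomiIntegral_eq] at e0
  have hG2 : Complex.Gamma (0 + 2) = 1 := by
    rw [show (0 + 2 : ℂ) = 1 + 1 by norm_num, Complex.Gamma_add_one _ one_ne_zero,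
      Complex.Gamma_one, mul_one]
  rw [hG2] at e0
  simp only [zero_add, Complex.Gamma_one, sub_self, inv_one, one_mul] at e0
  rw [show (2 : ℂ) - 1 = 0 + 1 by norm_num, show b - 2 - 1 = b - 3 by ring,
    show b - 1 - 1 = (b - 3) + 1 by ring] at e0
  have e1 := tricomiJ_add_one_right (α := 0) (b - 3) (x := x) (by simp) hx
  have i1 := (integrableOn_tricomiKernel (α := 0) (b - 2) (x := x) (by simp) hx).const_mul (-x : ℂ)
  have i2 := (integrableOn_tricomiKernel (α := 0) (b - 2 - 1) (x := x)
    (by simp) hx).const_mul (b - 2)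
  have key := MeasureTheory.integral_Ioi_of_hasDerivAt_of_tendsto'
    (fun t (ht : t ∈ Ici (0 : ℝ)) => hasDerivAt_tricomiKernel_zero_left (b - 2) x
      (by have : (0 : ℝ) ≤ t := ht; linarith))
    (i1.add i2) (tendsto_tricomiKernel_atTop 0 (b - 2) hx)
  rw [MeasureTheory.integral_add i1 i2, MeasureTheory.integral_const_mul,
    MeasureTheory.integral_const_mul] at key
  change -x * tricomiJ 0 (b - 2) x + (b - 2) * tricomiJ 0 (b - 2 - 1) x = _ at key
  have h0 : tricomiKernel 0 (b - 2) x 0 = 1 := by simp [tricomiKernel]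
  rw [h0, show b - 2 - 1 = b - 3 by ring, show b - 2 = (b - 3) + 1 by ring, e1] at key
  rw [e0, e1]
  simp only [zero_add] at key ⊢
  linear_combination -key

/-- Kummer's equation `x U'' + (b - x) U' = a U`, in terms of `U' = -a U(a + 1, b + 1)` and
`U'' = a (a + 1) U(a + 2, b + 2)`. -/
lemma kummer_tricomiU (a b : ℂ) {x : ℝ} (hx : 0 < x) :
    x * (a * (a + 1) * tricomiU (a + 2) (b + 2) x)
      + (b - x) * (-a * tricomiU (a + 1) (b + 1) x) = a * tricomiU a b x := by
  have x1 := mul_tricomiU_add_one_add_one (a + 1) (b + 1) hx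
  rw [show b + 1 + 1 = b + 2 by ring, show a + 1 + 1 = a + 2 by ring] at x1
  linear_combination a * (a + 1) * x1 + a * mul_tricomiU_add_one_add_one a b hx
    + a * (a - b + 1) * tricomiU_add_one_right a b hx

/-! ### The Riccati equation for `-w ∂_w U / U` -/

section Mode

variable {d : ℕ} {Λ : ℝ}

lemma tensorMode_arg_pos (hd : 2 ≤ d) {w : ℝ} (hw : 0 < w) : 0 < ((d : ℝ) - 1) / 2 * w ^ 2 := by
  have : (2 : ℝ) ≤ d := by exact_mod_cast hd
  have : 0 < (d : ℝ) - 1 := by linarith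
  positivity

/-- The derivative `∂_x U = -a U(a + 1, b + 1)` at the arguments of `tensorMode`. -/
noncomputable def tensorModeSlope (d : ℕ) (Λ : ℝ) (s : ℂ) (w : ℝ) : ℂ :=
  -momentumParam d Λ s *
    tricomiU (momentumParam d Λ s + 1) (1 - (d : ℂ) / 2 + 1) (((d : ℝ) - 1) / 2 * w ^ 2)

lemma hasDerivAt_tensorMode_arg (d : ℕ) (w : ℝ) :
    HasDerivAt (fun w : ℝ => ((d : ℝ) - 1) / 2 * w ^ 2) (((d : ℝ) - 1) * w) w := by
  convert! ((hasDerivAt_id w).fun_pow 2).const_mul (((d : ℝ) - 1) / 2) using 1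
  simp
  ring

lemma hasDerivAt_tensorMode (hd : 2 ≤ d) (s : ℂ) {w : ℝ} (hw : 0 < w) :
    HasDerivAt (tensorMode d Λ s) (((d : ℝ) - 1) * w * tensorModeSlope d Λ s w) w := by
  have h := HasDerivAt.scomp w (hasDerivAt_tricomiU (momentumParam d Λ s) (1 - (d : ℂ) / 2)
    (tensorMode_arg_pos hd hw)) (hasDerivAt_tensorMode_arg d w)
  convert! h using 1
  simp [tensorModeSlope]

lemma hasDerivAt_tensorModeSlope (hd : 2 ≤ d) (s : ℂ) {w : ℝ} (hw : 0 < w) :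
    HasDerivAt (tensorModeSlope d Λ s) (((d : ℝ) - 1) * w * (momentumParam d Λ s *
      (momentumParam d Λ s + 1) * tricomiU (momentumParam d Λ s + 2) (1 - (d : ℂ) / 2 + 2)
        (((d : ℝ) - 1) / 2 * w ^ 2))) w := by
  have h := (HasDerivAt.scomp w (hasDerivAt_tricomiU (momentumParam d Λ s + 1)
    (1 - (d : ℂ) / 2 + 1) (tensorMode_arg_pos hd hw)) (hasDerivAt_tensorMode_arg d w)).const_mul
    (-momentumParam d Λ s)
  convert! h using 1
  rw [show momentumParam d Λ s + 1 + 1 = momentumParam d Λ s + 2 by ring,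
    show 1 - (d : ℂ) / 2 + 1 + 1 = 1 - (d : ℂ) / 2 + 2 by ring]
  simp only [Complex.real_smul]
  push_cast
  ring

lemma tricomiResponse_eq (hd : 2 ≤ d) (s : ℂ) {w : ℝ} (hw : 0 < w) :
    tricomiResponse d Λ s w
      = -(((d : ℂ) - 1) * (w : ℂ) ^ 2 * tensorModeSlope d Λ s w) / tensorMode d Λ s w := by
  unfold tricomiResponse
  rw [(hasDerivAt_tensorMode hd s hw).deriv]
  push_cast
  ring

lemma mul_momentumParam (hd : 2 ≤ d) (hΛ : 0 < Λ) (s : ℂ) :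
    2 * ((d : ℂ) - 1) * momentumParam d Λ s = s / (Λ : ℂ) ^ 2 := by
  have h1 : ((d : ℂ) - 1) ≠ 0 := by
    rw [sub_ne_zero]; norm_cast; omega
  have h2 : (Λ : ℂ) ≠ 0 := by exact_mod_cast hΛ.ne'
  unfold momentumParam
  field_simp

lemma tricomiResponse_riccati (hd : 2 ≤ d) (hΛ : 0 < Λ) (s : ℂ) {w : ℝ} (hw : 0 < w)
    (h0 : tensorMode d Λ s w ≠ 0) : ∃ E' : ℂ, HasDerivAt (tricomiResponse d Λ s) E' w ∧
      w * E' - tricomiResponse d Λ s w ^ 2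
        - ((d : ℂ) + ((d : ℂ) - 1) * (w : ℂ) ^ 2) * tricomiResponse d Λ s w
        + s / (Λ : ℂ) ^ 2 * (w : ℂ) ^ 2 = 0 := by
  have hw2 : HasDerivAt (fun w : ℝ => ((d : ℂ) - 1) * (w : ℂ) ^ 2) (((d : ℂ) - 1) * (2 * w)) w := by
    have := ((hasDerivAt_id w).ofReal_comp.fun_pow 2).const_mul ((d : ℂ) - 1)
    simpa using this
  have h := ((hw2.fun_mul (hasDerivAt_tensorModeSlope (Λ := Λ) hd s hw)).fun_neg).fun_div
    (hasDerivAt_tensorMode hd s hw) h0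
  refine ⟨_, h.congr_of_eventuallyEq ?_, ?_⟩
  · filter_upwards [Ioi_mem_nhds hw] with y hy
    exact tricomiResponse_eq hd s hy
  · have hk := kummer_tricomiU (momentumParam d Λ s) (1 - (d : ℂ) / 2) (tensorMode_arg_pos hd hw)
    have hs := mul_momentumParam hd hΛ s
    rw [tricomiResponse_eq hd s hw, ← hs]
    have hS : -momentumParam d Λ s * tricomiU (momentumParam d Λ s + 1) (1 - (d : ℂ) / 2 + 1)
      (((d : ℝ) - 1) / 2 * w ^ 2) = tensorModeSlope d Λ s w := rfl
    have hU : tricomiU (momentumParam d Λ s) (1 - (d : ℂ) / 2)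
      (((d : ℝ) - 1) / 2 * w ^ 2) = tensorMode d Λ s w := rfl
    rw [hS, hU] at hk
    push_cast at hk ⊢
    generalize tricomiU (momentumParam d Λ s + 2) (1 - (d : ℂ) / 2 + 2)
      (((d : ℝ) - 1) / 2 * w ^ 2) = U2 at *
    generalize momentumParam d Λ s = a at *
    generalize tensorMode d Λ s w = U at *
    generalize tensorModeSlope d Λ s w = V at *
    field_simp
    linear_combination (-2 * ((d : ℂ) - 1) * (w : ℂ) ^ 2 * U) * hk

end Mode

/-! ### Uniqueness of the infrared regular response -/

/-- The fluctuation `exp (-∫₁^z e^A E)` whose response function is `E`. -/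
noncomputable def fluctuation (A E : ℝ → ℝ) (z : ℝ) : ℝ :=
  Real.exp (-∫ t in (1 : ℝ)..z, Real.exp (A t) * E t)

lemma fluctuation_pos (A E : ℝ → ℝ) (z : ℝ) : 0 < fluctuation A E z := Real.exp_pos _

lemma mul_sub_le_sub_of_le_hasDerivAt {f f' : ℝ → ℝ} {c z₁ : ℝ}
    (hf : ∀ z, z₁ ≤ z → HasDerivAt f (f' z) z) (hc : ∀ z, z₁ ≤ z → c ≤ f' z) {z : ℝ} (hz : z₁ ≤ z) :
    c * (z - z₁) ≤ f z - f z₁ := by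
  refine Convex.mul_sub_le_image_sub_of_le_deriv (convex_Ici z₁)
    (fun y hy => (hf y hy).continuousAt.continuousWithinAt)
    (fun y hy => (hf y (interior_subset hy)).differentiableAt.differentiableWithinAt)
    (fun y hy => ?_) z₁ self_mem_Ici z hz hz
  rw [(hf y (interior_subset hy)).deriv]
  exact hc y (interior_subset hy)

lemma antitoneOn_of_hasDerivAt_nonpos {f f' : ℝ → ℝ} (hf : ∀ z, 0 < z → HasDerivAt f (f' z) z)
    (hc : ∀ z, 0 < z → f' z ≤ 0) : AntitoneOn f (Ioi 0) := by
  refine antitoneOn_of_deriv_nonpos (convex_Ioi 0)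
    (fun y hy => (hf y hy).continuousAt.continuousWithinAt)
    (fun y hy => (hf y (interior_subset hy)).differentiableAt.differentiableWithinAt)
    (fun y hy => ?_)
  rw [(hf y (interior_subset hy)).deriv]
  exact hc y (interior_subset hy)

section Uniqueness

variable {d : ℕ} {A E F : ℝ → ℝ} {psq : ℝ}

lemma continuousOn_exp_mul (hA : ∀ z, 0 < z → DifferentiableAt ℝ A z)
    (hE : IsTensorResponse d A psq E) : ContinuousOn (fun t => Real.exp (A t) * E t) (Ioi 0) :=
  fun z hz => ((hA z hz).continuousAt.rexp.mul (hE z hz).continuousAt).continuousWithinAt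

lemma intervalIntegrable_exp_mul (hA : ∀ z, 0 < z → DifferentiableAt ℝ A z)
    (hE : IsTensorResponse d A psq E) {y z : ℝ} (hy : 0 < y) (hz : 0 < z) :
    IntervalIntegrable (fun t => Real.exp (A t) * E t) MeasureTheory.volume y z :=
  ((continuousOn_exp_mul hA hE).mono fun _ ht =>
    lt_of_lt_of_le (lt_min hy hz) ht.1).intervalIntegrable

lemma hasDerivAt_fluctuation (hA : ∀ z, 0 < z → DifferentiableAt ℝ A z)
    (hE : IsTensorResponse d A psq E) {z : ℝ} (hz : 0 < z) :
    HasDerivAt (fluctuation A E) (-(Real.exp (A z) * E z * fluctuation A E z)) z := by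
  have hc := continuousOn_exp_mul hA hE
  have h := intervalIntegral.integral_hasDerivAt_right
    (intervalIntegrable_exp_mul hA hE one_pos hz)
    (hc.stronglyMeasurableAtFilter isOpen_Ioi z hz) (hc.continuousAt (Ioi_mem_nhds hz))
  convert! h.fun_neg.exp using 1
  unfold fluctuation
  ring

lemma exists_fluctuation_le (hA : ∀ z, 0 < z → DifferentiableAt ℝ A z)
    (hE : IsTensorResponse d A psq E) (hreg : IsIRRegular A E) :
    ∃ z₀ C : ℝ, ∀ z, z₀ ≤ z → fluctuation A E z ≤ C := by
  obtain ⟨z₀, hz₀, B, hB⟩ := hreg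
  refine ⟨z₀, Real.exp (-(∫ t in (1 : ℝ)..z₀, Real.exp (A t) * E t) + B), fun z hz => ?_⟩
  have h1 : -∫ t in z₀..z, Real.exp (A t) * E t ≤ B := hB ⟨z, hz, rfl⟩
  have h2 := intervalIntegral.integral_add_adjacent_intervals
    (intervalIntegrable_exp_mul hA hE one_pos hz₀)
    (intervalIntegrable_exp_mul hA hE hz₀ (lt_of_lt_of_le hz₀ hz))
  exact Real.exp_le_exp.2 (by linarith)

lemma hasDerivAt_exp_natCast_mul (hA : ∀ z, 0 < z → DifferentiableAt ℝ A z) {z : ℝ} (hz : 0 < z) :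
    HasDerivAt (fun z => Real.exp (d * A z)) (Real.exp (d * A z) * (d * deriv A z)) z :=
  ((hA z hz).hasDerivAt.const_mul (d : ℝ)).exp

lemma exp_neg_mul_mono (hd : 1 ≤ d) (hanti : AntitoneOn A (Ioi 0)) {y z : ℝ} (hy : 0 < y)
    (hyz : y ≤ z) : Real.exp (A y - d * A y) ≤ Real.exp (A z - d * A z) := by
  have h1 : (1 : ℝ) ≤ d := by exact_mod_cast hd
  have h2 := hanti hy (lt_of_lt_of_le hy hyz : z ∈ Ioi 0) hyz
  apply Real.exp_le_exp.2
  nlinarith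

/-- The momentum `e^{dA} E f` of the fluctuation `f` is antitone. If `E` were negative somewhere,
then `f' = -e^A E f` would be bounded below by a positive constant from there on, and `f` would be
unbounded. -/
lemma IsTensorResponse.nonneg (hd : 1 ≤ d) (hA : ∀ z, 0 < z → DifferentiableAt ℝ A z)
    (hanti : AntitoneOn A (Ioi 0)) (hp : 0 ≤ psq) (hE : IsTensorResponse d A psq E)
    (hreg : IsIRRegular A E) {z : ℝ} (hz : 0 < z) : 0 ≤ E z := by
  by_contra! hneg
  set f := fluctuation A E with hf
  have hf' := fun y (hy : 0 < y) => hasDerivAt_fluctuation hA hE hy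
  have hH : AntitoneOn (fun y => Real.exp (d * A y) * E y * f y) (Ioi 0) := by
    refine antitoneOn_of_hasDerivAt_nonpos
      (f' := fun y => -(psq * (Real.exp (d * A y) * Real.exp (-A y) * f y))) (fun y hy => ?_)
      (fun y hy => ?_)
    · convert! ((hasDerivAt_exp_natCast_mul hA hy).fun_mul (hE y hy)).fun_mul (hf' y hy) using 1
      ring
    · have := fluctuation_pos A E y
      have : 0 ≤ psq * (Real.exp (d * A y) * Real.exp (-A y) * f y) := by positivity
      linarith
  set c := Real.exp (A z - d * A z) * -(Real.exp (d * A z) * E z * f z) with hc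
  have hfz := fluctuation_pos A E z
  have hHz : 0 < -(Real.exp (d * A z) * E z * f z) := by
    have : 0 < Real.exp (d * A z) * -E z * f z :=
      mul_pos (mul_pos (Real.exp_pos _) (by linarith)) hfz
    linarith
  have hcpos : 0 < c := mul_pos (Real.exp_pos _) hHz
  obtain ⟨z₀, C, hC⟩ := exists_fluctuation_le hA hE hreg
  have hlow : ∀ y, z ≤ y → c ≤ -(Real.exp (A y) * E y * f y) := by
    intro y hy
    have hy0 : 0 < y := lt_of_lt_of_le hz hy
    have h1 := hH hz hy0 hy
    have h2 := exp_neg_mul_mono hd hanti hz hy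
    have h3 : Real.exp (A y) = Real.exp (A y - d * A y) * Real.exp (d * A y) := by
      rw [← Real.exp_add]; ring_nf
    calc c ≤ Real.exp (A y - d * A y) * -(Real.exp (d * A y) * E y * f y) :=
          mul_le_mul h2 (by simpa using h1) hHz.le (Real.exp_pos _).le
      _ = _ := by rw [h3]; ring
  set y := max (max z z₀) (z + (|C| + 1) / c)
  have hy1 : z ≤ y := (le_max_left _ _).trans (le_max_left _ _)
  have hy2 : z₀ ≤ y := (le_max_right _ _).trans (le_max_left _ _)
  have hy3 : (|C| + 1) / c ≤ y - z := by linarith [le_max_right (max z z₀) (z + (|C| + 1) / c)]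
  have h4 := mul_sub_le_sub_of_le_hasDerivAt (fun y hy => hf' y (lt_of_lt_of_le hz hy)) hlow hy1
  rw [div_le_iff₀ hcpos] at hy3
  have := hC y hy2
  linarith [le_abs_self C, mul_comm c (y - z)]

/-- The Wronskian `e^{dA} (E - F) f g` of two fluctuations is constant. If it were positive, then
`f' = -e^A E f` would be bounded above by a negative constant, and `f` would become negative. -/
lemma IsTensorResponse.le (hd : 1 ≤ d) (hA : ∀ z, 0 < z → DifferentiableAt ℝ A z)
    (hanti : AntitoneOn A (Ioi 0)) (hE : IsTensorResponse d A psq E)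
    (hF : IsTensorResponse d A psq F) (hF0 : ∀ z, 0 < z → 0 ≤ F z) {z : ℝ} (hz : 0 < z) :
    E z ≤ F z := by
  by_contra! hlt
  set f := fluctuation A E with hf
  set g := fluctuation A F with hg
  have hf' := fun y (hy : 0 < y) => hasDerivAt_fluctuation hA hE hy
  have hg' := fun y (hy : 0 < y) => hasDerivAt_fluctuation hA hF hy
  have hfpos := fluctuation_pos A E
  have hgpos := fluctuation_pos A F
  have hW : ∀ y, 0 < y →
      HasDerivAt (fun y => Real.exp (d * A y) * (E y - F y) * f y * g y) 0 y := by
    intro y hy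
    convert! (((hasDerivAt_exp_natCast_mul hA hy).fun_mul ((hE y hy).fun_sub (hF y hy))).fun_mul
      (hf' y hy)).fun_mul (hg' y hy) using 1
    ring
  set c := Real.exp (d * A z) * (E z - F z) * f z * g z with hc
  have hcpos : 0 < c :=
    mul_pos (mul_pos (mul_pos (Real.exp_pos _) (by linarith)) (hfpos z)) (hgpos z)
  have hWc : ∀ y, 0 < y → Real.exp (d * A y) * (E y - F y) * f y * g y = c := by
    intro y hy
    exact isOpen_Ioi.is_const_of_deriv_eq_zero isPreconnected_Ioi
      (fun u hu => (hW u hu).differentiableAt.differentiableWithinAt)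
      (fun u hu => (hW u hu).deriv) hy hz
  have hganti : AntitoneOn g (Ioi 0) := by
    refine antitoneOn_of_hasDerivAt_nonpos hg' fun y hy => ?_
    have := mul_nonneg (mul_nonneg (Real.exp_pos (A y)).le (hF0 y hy)) (hgpos y).le
    linarith
  set k := Real.exp (A z - d * A z) * (c / g z) with hk
  have hkpos : 0 < k := mul_pos (Real.exp_pos _) (div_pos hcpos (hgpos z))
  have hlow : ∀ y, z ≤ y → k ≤ Real.exp (A y) * E y * f y := by
    intro y hy
    have hy0 : 0 < y := lt_of_lt_of_le hz hy
    have h2 := exp_neg_mul_mono hd hanti hz hy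
    have h3 : Real.exp (A y) = Real.exp (A y - d * A y) * Real.exp (d * A y) := by
      rw [← Real.exp_add]; ring_nf
    have h4 : c / g z ≤ Real.exp (d * A y) * E y * f y := by
      rw [div_le_iff₀ (hgpos z)]
      have h5 := hWc y hy0
      have h6 : 0 ≤ Real.exp (d * A y) * F y * f y * g y :=
        mul_nonneg (mul_nonneg (mul_nonneg (Real.exp_pos _).le (hF0 y hy0)) (hfpos y).le)
          (hgpos y).le
      have h7 : c ≤ Real.exp (d * A y) * E y * f y * g y := by linarith
      have h8 : 0 ≤ Real.exp (d * A y) * E y * f y := by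
        by_contra! h9
        nlinarith [hgpos y]
      exact h7.trans (mul_le_mul_of_nonneg_left (hganti hz hy0 hy) h8)
    calc k ≤ Real.exp (A y - d * A y) * (Real.exp (d * A y) * E y * f y) :=
          mul_le_mul h2 h4 (div_pos hcpos (hgpos z)).le (Real.exp_pos _).le
      _ = _ := by rw [h3]; ring
  have h4 := mul_sub_le_sub_of_le_hasDerivAt (f := fun y => -f y) (c := k)
    (fun y hy => (hf' y (lt_of_lt_of_le hz hy)).fun_neg)
    (fun y hy => by simpa using hlow y hy) (z := z + f z / k)
    (by have := div_pos (hfpos z) hkpos; linarith)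
  rw [add_sub_cancel_left, mul_div_cancel₀ _ hkpos.ne'] at h4
  linarith [hfpos (z + f z / k)]

/-- There is at most one infrared regular tensor response function. -/
lemma IsTensorResponse.eqOn (hd : 1 ≤ d) (hA : ∀ z, 0 < z → DifferentiableAt ℝ A z)
    (hanti : AntitoneOn A (Ioi 0)) (hp : 0 ≤ psq) (hE : IsTensorResponse d A psq E)
    (hF : IsTensorResponse d A psq F) (hEreg : IsIRRegular A E) (hFreg : IsIRRegular A F) :
    EqOn E F (Ioi 0) := fun _ hz =>
  le_antisymm
    (IsTensorResponse.le hd hA hanti hE hF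
      (fun _ hy => IsTensorResponse.nonneg hd hA hanti hp hF hFreg hy) hz)
    (IsTensorResponse.le hd hA hanti hF hE
      (fun _ hy => IsTensorResponse.nonneg hd hA hanti hp hE hEreg hy) hz)

end Uniqueness

/-! ### Existence of the infrared regular response -/

lemma tricomiJ_ofReal {α c x : ℝ} (hα : -1 < α) (hx : 0 < x) :
    ∃ r : ℝ, 0 < r ∧ tricomiJ α c x = r := by
  have hk : ∀ t ∈ Ioi (0 : ℝ), tricomiKernel α c x t
      = ((Real.exp (-(x * t)) * t ^ α * (1 + t) ^ c : ℝ) : ℂ) := by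
    intro t ht
    have ht' : (0 : ℝ) < t := ht
    unfold tricomiKernel
    rw [Complex.ofReal_mul (_ * _), Complex.ofReal_mul (Real.exp _), Complex.ofReal_cpow ht'.le,
      Complex.ofReal_cpow (by linarith : (0 : ℝ) ≤ 1 + t), Complex.ofReal_exp]
    simp
  have hint : MeasureTheory.IntegrableOn
      (fun t : ℝ => Real.exp (-(x * t)) * t ^ α * (1 + t) ^ c) (Ioi 0) := by
    refine (integrableOn_tricomiKernel (α := α) c (by simpa using hα) hx).norm.congr ?_
    filter_upwards [MeasureTheory.ae_restrict_mem measurableSet_Ioi] with t ht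
    rw [norm_tricomiKernel ht]
    simp
  refine ⟨∫ t in Ioi (0 : ℝ), Real.exp (-(x * t)) * t ^ α * (1 + t) ^ c, ?_, ?_⟩
  · have hpos : ∀ t ∈ Ioi (0 : ℝ), 0 < Real.exp (-(x * t)) * t ^ α * (1 + t) ^ c := by
      intro t ht
      have ht' : (0 : ℝ) < t := ht
      positivity
    rw [MeasureTheory.setIntegral_pos_iff_support_of_nonneg_ae
      (by filter_upwards [MeasureTheory.ae_restrict_mem measurableSet_Ioi] with t ht
          exact (hpos t ht).le) hint,
      inter_eq_right.2 (show Ioi (0 : ℝ) ⊆ Function.support _ from fun t ht => (hpos t ht).ne')]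
    simp
  · unfold tricomiJ
    rw [MeasureTheory.setIntegral_congr_fun measurableSet_Ioi hk, integral_complex_ofReal]

lemma tricomiU_ofReal {a x : ℝ} (b : ℝ) (ha : 0 ≤ a) (hx : 0 < x) :
    ∃ r : ℝ, 0 < r ∧ tricomiU a b x = r := by
  rcases ha.eq_or_lt with rfl | ha
  · exact ⟨1, one_pos, by simpa using tricomiU_zero b hx⟩
  · obtain ⟨r, hr, h⟩ := tricomiJ_ofReal (α := a - 1) (c := b - a - 1) (x := x) (by linarith) hx
    refine ⟨(Real.Gamma a)⁻¹ * r, mul_pos (inv_pos.2 (Real.Gamma_pos_of_pos ha)) hr, ?_⟩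
    rw [tricomiU_eq_tricomiIntegral _ hx (by simpa using ha), tricomiIntegral_eq,
      Complex.Gamma_ofReal]
    push_cast at h ⊢
    rw [h]

section Existence

variable {d : ℕ} {Λ L : ℝ}

lemma momentumParam_ofReal (hd : 2 ≤ d) (hΛ : 0 < Λ) {psq : ℝ} (hp : 0 ≤ psq) :
    ∃ a : ℝ, 0 ≤ a ∧ momentumParam d Λ psq = a := by
  have : (2 : ℝ) ≤ d := by exact_mod_cast hd
  have h1 : 0 < (d : ℝ) - 1 := by linarith
  refine ⟨psq / (2 * ((d : ℝ) - 1) * Λ ^ 2), by positivity, ?_⟩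
  unfold momentumParam
  push_cast
  rfl

lemma tensorMode_ne_zero (hd : 2 ≤ d) (hΛ : 0 < Λ) {psq : ℝ} (hp : 0 ≤ psq) {w : ℝ} (hw : 0 < w) :
    tensorMode d Λ psq w ≠ 0 := by
  obtain ⟨a, ha, h⟩ := momentumParam_ofReal hd hΛ hp
  obtain ⟨r, hr, h'⟩ := tricomiU_ofReal (1 - (d : ℝ) / 2) ha (tensorMode_arg_pos hd hw)
  unfold tensorMode
  rw [h]
  push_cast at h' ⊢
  rw [h']
  exact_mod_cast hr.ne'

lemma tricomiResponse_ofReal (hd : 2 ≤ d) (hΛ : 0 < Λ) {psq : ℝ} (hp : 0 ≤ psq) {w : ℝ}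
    (hw : 0 < w) : ∃ r : ℝ, 0 ≤ r ∧ tricomiResponse d Λ psq w = r := by
  obtain ⟨a, ha, h⟩ := momentumParam_ofReal hd hΛ hp
  obtain ⟨r, hr, h'⟩ := tricomiU_ofReal (1 - (d : ℝ) / 2) ha (tensorMode_arg_pos hd hw)
  obtain ⟨q, hq, h''⟩ := tricomiU_ofReal (a := a + 1) (1 - (d : ℝ) / 2 + 1) (by linarith)
    (tensorMode_arg_pos hd hw)
  have : (2 : ℝ) ≤ d := by exact_mod_cast hd
  have h1 : 0 ≤ (d : ℝ) - 1 := by linarith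
  refine ⟨((d : ℝ) - 1) * w ^ 2 * (a * q) / r, by positivity, ?_⟩
  rw [tricomiResponse_eq hd _ hw]
  unfold tensorMode tensorModeSlope
  rw [h]
  push_cast at h' h'' ⊢
  rw [h', h'']
  ring

lemma hasDerivAt_warpFactor (Λ : ℝ) (hL : 0 < L) {z : ℝ} (hz : 0 < z) :
    HasDerivAt (warpFactor Λ L) (-(Λ ^ 2 * z) - 1 / z) z := by
  have h : HasDerivAt (fun z : ℝ => -(Λ ^ 2 * z ^ 2) / 2 + (Real.log L - Real.log z))
      (-(Λ ^ 2 * z) - 1 / z) z := by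
    have h1 := ((((hasDerivAt_id z).fun_pow 2).const_mul (Λ ^ 2)).fun_neg).div_const 2
    convert! h1.fun_add ((Real.hasDerivAt_log hz.ne').const_sub (Real.log L)) using 1
    simp
    ring
  refine h.congr_of_eventuallyEq ?_
  filter_upwards [Ioi_mem_nhds hz] with y hy
  unfold warpFactor
  rw [Real.log_div hL.ne' (ne_of_gt hy)]

lemma antitoneOn_warpFactor (Λ : ℝ) (hL : 0 < L) : AntitoneOn (warpFactor Λ L) (Ioi 0) := by
  refine antitoneOn_of_hasDerivAt_nonpos (fun z hz => hasDerivAt_warpFactor Λ hL hz) fun z hz => ?_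
  have h1 : 0 ≤ Λ ^ 2 * z := by positivity
  have h2 : 0 ≤ 1 / z := by positivity
  linarith

lemma exp_warpFactor (Λ : ℝ) (hL : 0 < L) {z : ℝ} (hz : 0 < z) :
    Real.exp (warpFactor Λ L z) = (Real.exp ((Λ * z) ^ 2 / 2))⁻¹ * (L / z) := by
  unfold warpFactor
  rw [Real.exp_add, Real.exp_log (by positivity), ← Real.exp_neg]
  congr 2
  ring

/-- The response function `E(z) = L⁻¹ e^{Λ² z² / 2} Re 𝐄(Λ z)` with `𝐄 = -w ∂_w U / U`. -/
noncomputable def tricomiTensorResponse (d : ℕ) (Λ L psq z : ℝ) : ℝ :=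
  L⁻¹ * Real.exp ((Λ * z) ^ 2 / 2) * (tricomiResponse d Λ psq (Λ * z)).re

lemma isTensorResponse_tricomiTensorResponse (hd : 2 ≤ d) (hΛ : 0 < Λ) (hL : 0 < L) {psq : ℝ}
    (hp : 0 ≤ psq) :
    IsTensorResponse d (warpFactor Λ L) psq (tricomiTensorResponse d Λ L psq) := by
  intro z hz
  have hw : 0 < Λ * z := mul_pos hΛ hz
  obtain ⟨E', hE', heq⟩ := tricomiResponse_riccati hd hΛ psq hw (tensorMode_ne_zero hd hΛ hp hw)
  have hre : HasDerivAt (fun w => (tricomiResponse d Λ psq w).re) E'.re (Λ * z) := by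
    exact Complex.reCLM.hasFDerivAt.comp_hasDerivAt (Λ * z) hE'
  have hre' : HasDerivAt (fun z => (tricomiResponse d Λ psq (Λ * z)).re) (E'.re * Λ) z := by
    refine HasDerivAt.comp z (h := fun z => Λ * z) hre ?_
    simpa using (hasDerivAt_id z).const_mul Λ
  have hexp : HasDerivAt (fun z : ℝ => Real.exp ((Λ * z) ^ 2 / 2))
      (Real.exp ((Λ * z) ^ 2 / 2) * (Λ ^ 2 * z)) z := by
    have h1 : HasDerivAt (fun z : ℝ => (Λ * z) ^ 2 / 2) (Λ ^ 2 * z) z := by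
      convert! ((((hasDerivAt_id z).const_mul Λ).fun_pow 2).div_const 2) using 1
      simp
      ring
    exact h1.exp
  have h := (hexp.const_mul L⁻¹).fun_mul hre'
  unfold tricomiTensorResponse
  convert! h using 1
  obtain ⟨r, -, hr⟩ := tricomiResponse_ofReal hd hΛ hp hw
  have heq' := congrArg Complex.re heq
  rw [hr] at heq' ⊢
  have e1 : ((((Λ * z : ℝ) : ℂ)) * E').re = Λ * z * E'.re := Complex.re_ofReal_mul _ _
  have e2 : (r : ℂ) ^ 2 + ((d : ℂ) + ((d : ℂ) - 1) * ((Λ * z : ℝ) : ℂ) ^ 2) * r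
      - (psq : ℂ) / (Λ : ℂ) ^ 2 * ((Λ * z : ℝ) : ℂ) ^ 2
      = ((r ^ 2 + ((d : ℝ) + ((d : ℝ) - 1) * (Λ * z) ^ 2) * r - psq / Λ ^ 2 * (Λ * z) ^ 2 : ℝ) : ℂ) := by
    push_cast; ring
  have e3 : Λ * z * E'.re
      = r ^ 2 + ((d : ℝ) + ((d : ℝ) - 1) * (Λ * z) ^ 2) * r - psq / Λ ^ 2 * (Λ * z) ^ 2 := by
    rw [← e1, ← Complex.ofReal_re (r ^ 2 + _ - _), ← e2]
    have : ((Λ * z : ℝ) : ℂ) * E' = (r : ℂ) ^ 2 + ((d : ℂ) + ((d : ℂ) - 1) * ((Λ * z : ℝ) : ℂ) ^ 2) * r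
      - (psq : ℂ) / (Λ : ℂ) ^ 2 * ((Λ * z : ℝ) : ℂ) ^ 2 := by
      rw [hr] at heq
      linear_combination heq
    rw [this]
  have e4 : E'.re * Λ
      = (r ^ 2 + ((d : ℝ) + ((d : ℝ) - 1) * (Λ * z) ^ 2) * r - psq / Λ ^ 2 * (Λ * z) ^ 2) / z := by
    rw [← e3]; field_simp
  rw [e4, (hasDerivAt_warpFactor Λ hL hz).deriv, Real.exp_neg, exp_warpFactor Λ hL hz,
    Complex.ofReal_re]
  have he := (Real.exp_pos ((Λ * z) ^ 2 / 2)).ne'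
  field_simp
  ring

lemma isIRRegular_tricomiTensorResponse (hd : 2 ≤ d) (hΛ : 0 < Λ) (hL : 0 < L) {psq : ℝ}
    (hp : 0 ≤ psq) : IsIRRegular (warpFactor Λ L) (tricomiTensorResponse d Λ L psq) := by
  refine ⟨1, one_pos, 0, ?_⟩
  rintro _ ⟨z, hz, rfl⟩
  have : 0 ≤ ∫ t in (1 : ℝ)..z,
      Real.exp (warpFactor Λ L t) * tricomiTensorResponse d Λ L psq t := by
    refine intervalIntegral.integral_nonneg hz fun t ht => ?_
    have ht0 : 0 < t := lt_of_lt_of_le one_pos ht.1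
    obtain ⟨r, hr, h⟩ := tricomiResponse_ofReal hd hΛ hp (mul_pos hΛ ht0)
    unfold tricomiTensorResponse
    rw [h, Complex.ofReal_re]
    positivity
  simpa using this

lemma dimlessResponse_tricomiTensorResponse (hd : 2 ≤ d) (hΛ : 0 < Λ) (hL : 0 < L) {psq : ℝ}
    (hp : 0 ≤ psq) {w : ℝ} (hw : 0 < w) :
    (dimlessResponse Λ L (tricomiTensorResponse d Λ L psq) w : ℂ) = tricomiResponse d Λ psq w := by
  obtain ⟨r, -, h⟩ := tricomiResponse_ofReal hd hΛ hp hw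
  unfold dimlessResponse tricomiTensorResponse
  rw [mul_div_cancel₀ _ hΛ.ne', h, Complex.ofReal_re, Real.exp_neg]
  have he := (Real.exp_pos (w ^ 2 / 2)).ne'
  congr 1
  field_simp

end Existence

/-! ### The beta integral over the half line and the digamma function -/

lemma ofReal_cpow_eq_exp {x : ℝ} (hx : 0 < x) (c : ℂ) :
    (x : ℂ) ^ c = Complex.exp ((Real.log x : ℝ) * c) := by
  rw [Complex.cpow_def_of_ne_zero (by exact_mod_cast hx.ne'), Complex.ofReal_log hx.le]

lemma tricomiKernel_zero_right (α c : ℂ) (t : ℝ) :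
    tricomiKernel α c 0 t = (t : ℂ) ^ α * ((1 + t : ℝ) : ℂ) ^ c := by
  simp [tricomiKernel]

lemma tricomiKernel_eq_exp_mul (α c : ℂ) (x t : ℝ) :
    tricomiKernel α c x t = Complex.exp (-(x * t : ℝ)) * tricomiKernel α c 0 t := by
  rw [tricomiKernel_zero_right, tricomiKernel, mul_assoc]

lemma hasDerivAt_div_one_add {t : ℝ} (ht : 0 < t) :
    HasDerivAt (fun t : ℝ => t / (1 + t)) (((1 + t) ^ 2)⁻¹) t := by
  convert! (hasDerivAt_id t).fun_div ((hasDerivAt_id t).const_add 1) (by simp; linarith) using 1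
  simp

lemma injOn_div_one_add : InjOn (fun t : ℝ => t / (1 + t)) (Ioi 0) := by
  intro s hs t ht h
  have hs' : (0 : ℝ) < s := hs
  have ht' : (0 : ℝ) < t := ht
  simp only at h
  field_simp at h
  linarith

lemma image_div_one_add : (fun t : ℝ => t / (1 + t)) '' Ioi 0 = Ioo 0 1 := by
  ext y
  constructor
  · rintro ⟨t, ht, rfl⟩
    have ht' : (0 : ℝ) < t := ht
    refine ⟨by positivity, ?_⟩
    simp only
    rw [div_lt_one (by linarith)]
    linarith
  · rintro ⟨h0, h1⟩
    have h2 : 0 < 1 - y := by linarith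
    refine ⟨y / (1 - y), div_pos h0 h2, ?_⟩
    simp only
    field_simp
    ring

lemma betaIntegrand_div_one_add (a s : ℂ) {t : ℝ} (ht : 0 < t) :
    |((1 + t) ^ 2)⁻¹| • (((t / (1 + t) : ℝ) : ℂ) ^ (a - 1)
      * (1 - ((t / (1 + t) : ℝ) : ℂ)) ^ (s - 1)) = tricomiKernel (a - 1) (-a - s) 0 t := by
  have h1 : 0 < 1 + t := by linarith
  have e1 : (1 : ℂ) - ((t / (1 + t) : ℝ) : ℂ) = ((1 / (1 + t) : ℝ) : ℂ) := by
    rw [← Complex.ofReal_one, ← Complex.ofReal_sub]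
    congr 1
    field_simp
    ring
  have e2 : |((1 + t) ^ 2)⁻¹| = Real.exp (-(2 * Real.log (1 + t))) := by
    rw [abs_of_pos (by positivity), Real.exp_neg, mul_comm, Real.exp_mul, Real.exp_log h1]
    norm_num
  rw [tricomiKernel_zero_right, e1, e2, ofReal_cpow_eq_exp (by positivity),
    ofReal_cpow_eq_exp (by positivity), ofReal_cpow_eq_exp ht, ofReal_cpow_eq_exp h1,
    Real.log_div ht.ne' h1.ne', Real.log_div one_ne_zero h1.ne', Real.log_one, Complex.real_smul,
    Complex.ofReal_exp, ← Complex.exp_add, ← Complex.exp_add, ← Complex.exp_add]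
  congr 1
  push_cast
  ring

lemma integrableOn_tricomiKernel_zero_right {a s : ℂ} (ha : 0 < a.re) (hs : 0 < s.re) :
    MeasureTheory.IntegrableOn (tricomiKernel (a - 1) (-a - s) 0) (Ioi 0) := by
  have h := (intervalIntegrable_iff_integrableOn_Ioo_of_le zero_le_one).1
    (Complex.betaIntegral_convergent ha hs)
  rw [← image_div_one_add, MeasureTheory.integrableOn_image_iff_integrableOn_abs_deriv_smul
    measurableSet_Ioi (fun t ht => (hasDerivAt_div_one_add ht).hasDerivWithinAt)
    injOn_div_one_add] at h
  exact h.congr_fun (fun t ht => betaIntegrand_div_one_add a s ht) measurableSet_Ioi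

lemma tricomiJ_zero_right {a s : ℂ} (ha : 0 < a.re) (hs : 0 < s.re) :
    tricomiJ (a - 1) (-a - s) 0 = Complex.Gamma a * Complex.Gamma s / Complex.Gamma (a + s) := by
  rw [← Complex.betaIntegral_eq_Gamma_mul_div a s ha hs, Complex.betaIntegral,
    intervalIntegral.integral_of_le zero_le_one, MeasureTheory.integral_Ioc_eq_integral_Ioo,
    ← image_div_one_add, MeasureTheory.integral_image_eq_integral_abs_deriv_smul
    measurableSet_Ioi (fun t ht => (hasDerivAt_div_one_add ht).hasDerivWithinAt)
    injOn_div_one_add]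
  exact (MeasureTheory.setIntegral_congr_fun measurableSet_Ioi
    fun t ht => betaIntegrand_div_one_add a s ht).symm

/-- A multiplier bounded by `1` that tends pointwise to `1` may be removed under the integral. -/
lemma tendsto_setIntegral_mul {g : ℝ → ℂ} (hg : MeasureTheory.IntegrableOn g (Ioi 0))
    {m : ℝ → ℝ → ℂ} (hm : ∀ x, 0 < x → ContinuousOn (m x) (Ioi 0))
    (hb : ∀ x t, 0 < x → 0 < t → ‖m x t‖ ≤ 1)
    (hl : ∀ t, 0 < t → Tendsto (fun x => m x t) (𝓝[>] 0) (𝓝 1)) :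
    Tendsto (fun x : ℝ => ∫ t in Ioi (0 : ℝ), m x t * g t) (𝓝[>] 0)
      (𝓝 (∫ t in Ioi (0 : ℝ), g t)) := by
  refine MeasureTheory.tendsto_integral_filter_of_dominated_convergence (fun t => ‖g t‖) ?_ ?_
    hg.norm ?_
  · filter_upwards [self_mem_nhdsWithin] with x hx
    exact ((hm x hx).aestronglyMeasurable measurableSet_Ioi).mul hg.aestronglyMeasurable
  · filter_upwards [self_mem_nhdsWithin] with x hx
    filter_upwards [MeasureTheory.ae_restrict_mem measurableSet_Ioi] with t ht
    rw [norm_mul]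
    exact mul_le_of_le_one_left (norm_nonneg _) (hb x t hx ht)
  · filter_upwards [MeasureTheory.ae_restrict_mem measurableSet_Ioi] with t ht
    simpa using (hl t ht).mul_const (g t)

lemma tendsto_setIntegral_exp_mul {g : ℝ → ℂ} (hg : MeasureTheory.IntegrableOn g (Ioi 0)) :
    Tendsto (fun x : ℝ => ∫ t in Ioi (0 : ℝ), Complex.exp (-(x * t : ℝ)) * g t) (𝓝[>] 0)
      (𝓝 (∫ t in Ioi (0 : ℝ), g t)) := by
  refine tendsto_setIntegral_mul hg (fun x _ => by fun_prop) (fun x t hx ht => ?_) fun t _ => ?_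
  · have : 0 ≤ x * t := by positivity
    rw [Complex.norm_exp]
    simpa using this
  · have : ContinuousAt (fun x : ℝ => Complex.exp (-(x * t : ℝ))) 0 := by fun_prop
    have h := this.tendsto.mono_left (nhdsWithin_le_nhds (s := Ioi 0))
    simpa using h

lemma tendsto_setIntegral_one_add_cpow_mul {g : ℝ → ℂ}
    (hg : MeasureTheory.IntegrableOn g (Ioi 0)) :
    Tendsto (fun ε : ℝ => ∫ t in Ioi (0 : ℝ), ((1 + t : ℝ) : ℂ) ^ (-(ε : ℂ)) * g t) (𝓝[>] 0)
      (𝓝 (∫ t in Ioi (0 : ℝ), g t)) := by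
  refine tendsto_setIntegral_mul hg (fun x _ => ?_) (fun x t hx ht => ?_) fun t ht => ?_
  · exact ContinuousOn.cpow_const (by fun_prop) fun t ht => Or.inl (by
      have : (0 : ℝ) < t := ht
      simp only [Complex.ofReal_re]; linarith)
  · rw [Complex.norm_cpow_eq_rpow_re_of_pos (by linarith)]
    exact Real.rpow_le_one_of_one_le_of_nonpos (by linarith) (by simpa using hx.le)
  · have : ContinuousAt (fun ε : ℝ => ((1 + t : ℝ) : ℂ) ^ (-(ε : ℂ))) 0 := by
      refine ContinuousAt.const_cpow (by fun_prop) (Or.inl ?_)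
      exact_mod_cast (by linarith : (1 + t) ≠ 0)
    have h := this.tendsto.mono_left (nhdsWithin_le_nhds (s := Ioi 0))
    simpa using h

/-- The subtracted kernel `t^{a-1} (1+t)^{-a} - (1+t)^{-1}`. -/
noncomputable def digammaKernel (a : ℂ) (t : ℝ) : ℂ :=
  tricomiKernel (a - 1) (-a) 0 t - tricomiKernel 0 (-1) 0 t

/-- Split off `t^{a-1} (1+t)^{-a-1}`, which is integrable; the rest is `((t/(1+t))^a - 1) / (1+t)`,
continuous on `[0, ∞)` and `O(t⁻²)` at infinity since `y ↦ y^a` is differentiable at `1`. -/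
lemma integrableOn_digammaKernel {a : ℂ} (ha : 0 < a.re) :
    MeasureTheory.IntegrableOn (digammaKernel a) (Ioi 0) := by
  have ha0 := ne_zero_of_re_pos ha
  set G : ℝ → ℂ := fun t => (((t / (1 + t) : ℝ) : ℂ) ^ a - 1) * ((1 + t : ℝ) : ℂ)⁻¹ with hG
  have hcont : ContinuousOn G (Ici 0) := by
    intro t ht
    have ht' : (0 : ℝ) ≤ t := ht
    have h1 : ((1 + t : ℝ) : ℂ) ≠ 0 := by exact_mod_cast (by linarith : (1 + t) ≠ 0)
    have h2 : ContinuousAt (fun t : ℝ => t / (1 + t)) t :=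
      ContinuousAt.div (by fun_prop) (by fun_prop) (by linarith)
    refine ContinuousAt.continuousWithinAt (ContinuousAt.mul (ContinuousAt.sub ?_ continuousAt_const)
      (ContinuousAt.inv₀ (by fun_prop) h1))
    exact (Complex.continuousAt_ofReal_cpow_const _ _ (Or.inl ha)).comp
      (f := fun t : ℝ => t / (1 + t)) h2
  have hlim : Tendsto (fun t : ℝ => t / (1 + t)) atTop (𝓝 1) := by
    have h1 : Tendsto (fun t : ℝ => 1 - (1 + t)⁻¹) atTop (𝓝 (1 - 0)) :=
      (tendsto_inv_atTop_zero.comp (tendsto_atTop_add_const_left _ 1 tendsto_id)).const_sub 1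
    rw [sub_zero] at h1
    refine h1.congr' ?_
    filter_upwards [eventually_gt_atTop 0] with t ht
    field_simp
    ring
  have hO : G =O[atTop] (fun t : ℝ => t ^ (-2 : ℝ)) := by
    have h1 : (fun y : ℝ => (y : ℂ) ^ a - 1) =O[𝓝 1] fun y => y - 1 := by
      have := (hasDerivAt_ofReal_cpow one_pos (a - 1)).isBigO_sub
      simpa using this
    have h2 := h1.comp_tendsto hlim
    have h3 : (fun t : ℝ => ((1 + t : ℝ) : ℂ)⁻¹) =O[atTop] (fun t : ℝ => t⁻¹) := by
      refine IsBigO.of_bound 1 ?_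
      filter_upwards [eventually_gt_atTop 0] with t ht
      rw [norm_inv, norm_inv, Complex.norm_real, Real.norm_of_nonneg (by linarith),
        Real.norm_of_nonneg ht.le, one_mul]
      exact inv_anti₀ ht (by linarith)
    have h4 : ((fun y : ℝ => y - 1) ∘ fun t : ℝ => t / (1 + t)) =O[atTop] (fun t : ℝ => t⁻¹) := by
      refine IsBigO.of_bound 1 ?_
      filter_upwards [eventually_gt_atTop 0] with t ht
      have : t / (1 + t) - 1 = -(1 + t)⁻¹ := by field_simp; ring
      rw [Function.comp, this, norm_neg, norm_inv, norm_inv, Real.norm_of_nonneg (by linarith),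
        Real.norm_of_nonneg ht.le, one_mul]
      exact inv_anti₀ ht (by linarith)
    refine ((h2.trans h4).mul h3).trans (IsBigO.of_bound 1 ?_)
    filter_upwards [eventually_gt_atTop 0] with t ht
    rw [one_mul, Real.rpow_neg ht.le, Real.rpow_two, sq, mul_inv]
  have hGint : MeasureTheory.IntegrableOn G (Ioi 0) :=
    ((hcont.locallyIntegrableOn measurableSet_Ici).integrableOn_of_isBigO_atTop hO
      (integrableAtFilter_rpow_atTop_iff.2 (by norm_num))).mono_set Ioi_subset_Ici_self
  refine ((integrableOn_tricomiKernel_zero_right ha (s := 1) (by simp)).add hGint).congr_fun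
    (fun t ht => ?_) measurableSet_Ioi
  have ht' : (0 : ℝ) < t := ht
  have h1 : 0 < 1 + t := by linarith
  have e1 := tricomiKernel_add_one_right (a - 1) (-a - 1) 0 ht'
  rw [show -a - 1 + 1 = -a by ring, show a - 1 + 1 = a by ring] at e1
  have e2 : G t = tricomiKernel a (-a - 1) 0 t - tricomiKernel 0 (-1) 0 t := by
    rw [hG, tricomiKernel_zero_right, tricomiKernel_zero_right, Complex.cpow_zero,
      Complex.cpow_neg_one]
    simp only
    rw [sub_mul, one_mul]
    congr 1
    rw [← Complex.cpow_neg_one, ofReal_cpow_eq_exp (by positivity), ofReal_cpow_eq_exp ht',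
      ofReal_cpow_eq_exp h1, ofReal_cpow_eq_exp h1, Real.log_div ht'.ne' h1.ne',
      ← Complex.exp_add, ← Complex.exp_add]
    congr 1
    push_cast
    ring
  rw [Pi.add_apply, e2, digammaKernel, e1]
  ring

/-- `∫₀^∞ (t^{a-1} (1+t)^{-a} - (1+t)^{-1}) dt = -γ - ψ(a)`: with the factor `(1+t)^{-ε}` inserted
the integral is `Γ(a) Γ(ε) / Γ(a + ε) - 1 / ε`, a difference quotient of
`ε ↦ Γ(a) Γ(1 + ε) / Γ(a + ε)`. -/
lemma integral_digammaKernel {a : ℂ} (ha : 0 < a.re) :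
    ∫ t in Ioi (0 : ℝ), digammaKernel a t
      = -(Real.eulerMascheroniConstant : ℂ) - Complex.digamma a := by
  have hGa := Complex.Gamma_ne_zero_of_re_pos ha
  have hlim := tendsto_setIntegral_one_add_cpow_mul (integrableOn_digammaKernel ha)
  refine tendsto_nhds_unique hlim ?_
  have hd : HasDerivAt (fun ε : ℝ => Complex.Gamma a * Complex.Gamma (1 + ε) / Complex.Gamma (a + ε))
      (-(Real.eulerMascheroniConstant : ℂ) - Complex.digamma a) 0 := by
    have hne : ∀ m : ℕ, a ≠ -m := by
      intro m h
      rw [h] at ha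
      simp at ha
      linarith [(Nat.cast_nonneg m : (0 : ℝ) ≤ m)]
    have h1 : HasDerivAt (fun ε : ℝ => Complex.Gamma (1 + ε))
        (-(Real.eulerMascheroniConstant : ℂ)) 0 := by
      have h : HasDerivAt Complex.Gamma (-(Real.eulerMascheroniConstant : ℂ)) (1 + ((0 : ℝ) : ℂ)) := by
        simpa using Complex.hasDerivAt_Gamma_one
      exact (h.comp_const_add 1 _).comp_ofReal
    have h2 : HasDerivAt (fun ε : ℝ => Complex.Gamma (a + ε)) (deriv Complex.Gamma a) 0 := by
      have h : HasDerivAt Complex.Gamma (deriv Complex.Gamma a) (a + ((0 : ℝ) : ℂ)) := by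
        simpa using (Complex.differentiableAt_Gamma a hne).hasDerivAt
      exact (h.comp_const_add a _).comp_ofReal
    convert! (h1.const_mul (Complex.Gamma a)).fun_div h2 (by simpa using hGa) using 1
    rw [Complex.digamma_def, logDeriv_apply]
    simp only [Complex.ofReal_zero, add_zero, Complex.Gamma_one, mul_one]
    field_simp
  have hs := (hasDerivAt_iff_tendsto_slope.1 hd).mono_left
    (nhdsWithin_mono 0 fun x hx => (ne_of_gt hx : x ≠ 0))
  refine hs.congr' ?_
  filter_upwards [self_mem_nhdsWithin] with ε hε
  have hε' : (0 : ℝ) < ε := hε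
  have hεc : (ε : ℂ) ≠ 0 := by exact_mod_cast hε'.ne'
  have hεre : 0 < (ε : ℂ).re := by simpa using hε'
  have hfun : ∀ t ∈ Ioi (0 : ℝ), ((1 + t : ℝ) : ℂ) ^ (-(ε : ℂ)) * digammaKernel a t
      = tricomiKernel (a - 1) (-a - ε) 0 t - tricomiKernel (1 - 1) (-1 - ε) 0 t := by
    intro t ht
    have ht' : (0 : ℝ) < t := ht
    have h1 : ((1 + t : ℝ) : ℂ) ≠ 0 := by exact_mod_cast (by linarith : (1 + t) ≠ 0)
    rw [digammaKernel, sub_self]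
    simp only [tricomiKernel_zero_right]
    rw [sub_eq_add_neg (-a), sub_eq_add_neg (-1 : ℂ), Complex.cpow_add _ _ h1,
      Complex.cpow_add _ _ h1]
    ring
  rw [MeasureTheory.setIntegral_congr_fun measurableSet_Ioi hfun,
    MeasureTheory.integral_sub (integrableOn_tricomiKernel_zero_right ha hεre)
      (integrableOn_tricomiKernel_zero_right (a := 1) (by simp) hεre)]
  change _ = tricomiJ (a - 1) (-a - ε) 0 - tricomiJ (1 - 1) (-1 - ε) 0
  have hG1 : Complex.Gamma (1 + ε) ≠ 0 := Complex.Gamma_ne_zero_of_re_pos (by simp; linarith)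
  rw [tricomiJ_zero_right ha hεre, tricomiJ_zero_right (a := 1) (by simp) hεre,
    slope_def_module]
  rw [show (1 : ℂ) + ε = ε + 1 by ring, Complex.Gamma_add_one _ hεc] at hG1 ⊢
  simp only [sub_zero, Complex.ofReal_zero, add_zero, Complex.Gamma_one, mul_one, one_mul,
    Complex.real_smul, Complex.ofReal_inv]
  rw [div_self hGa]
  have h3 := right_ne_zero_of_mul hG1
  field_simp

lemma tendsto_tricomiJ_nhds_zero {a s : ℂ} (ha : 0 < a.re) (hs : 0 < s.re) :
    Tendsto (tricomiJ (a - 1) (-a - s)) (𝓝[>] 0)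
      (𝓝 (Complex.Gamma a * Complex.Gamma s / Complex.Gamma (a + s))) := by
  rw [← tricomiJ_zero_right ha hs]
  refine (tendsto_setIntegral_exp_mul (integrableOn_tricomiKernel_zero_right ha hs)).congr
    fun x => ?_
  exact MeasureTheory.integral_congr_ae
    (Eventually.of_forall fun t => (tricomiKernel_eq_exp_mul _ _ x t).symm)

/-! ### Behaviour of `U(a, 1 - n, x)` as `x → 0⁺` -/

lemma tendsto_mul_log_nhdsGT_zero :
    Tendsto (fun x : ℝ => (x : ℂ) * (Real.log x : ℂ)) (𝓝[>] 0) (𝓝 0) := by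
  have h := tendsto_log_mul_rpow_nhdsGT_zero one_pos
  have h2 := (Complex.continuous_ofReal.tendsto 0).comp h
  rw [Complex.ofReal_zero] at h2
  refine h2.congr fun x => ?_
  simp [mul_comm]

lemma tendsto_ofReal_nhdsGT_zero : Tendsto (fun x : ℝ => (x : ℂ)) (𝓝[>] 0) (𝓝 0) := by
  have := Complex.continuous_ofReal.tendsto 0
  rw [Complex.ofReal_zero] at this
  exact this.mono_left nhdsWithin_le_nhds

lemma hasDerivAt_tricomiU_one_one {x : ℝ} (hx : 0 < x) :
    HasDerivAt (tricomiU 1 1) (tricomiU 1 1 x - (x : ℂ)⁻¹) x := by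
  have hx' : (x : ℂ) ≠ 0 := by exact_mod_cast hx.ne'
  convert! hasDerivAt_tricomiU 1 1 hx using 1
  have h0 := tricomiU_zero 1 hx
  rw [tricomiU_contiguous 0 1 hx] at h0
  have h1 := mul_tricomiU_add_one_add_one 1 1 hx
  simp only [zero_add] at h0
  rw [show (1 : ℂ) + 1 = 2 by norm_num] at h1 ⊢
  have : (x : ℂ) * tricomiU 2 2 x = 1 - x * tricomiU 1 1 x := by
    linear_combination h1 + h0
  field_simp
  linear_combination this

/-- `U(1, 1, x) + log x` converges to a real number: with `g(x) = e^{-x} U(1, 1, x) + log x` one has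
`g' = (1 - e^{-x}) / x`, so that `g` is Lipschitz. -/
lemma exists_tendsto_tricomiU_one_one_add_log :
    ∃ C : ℝ, Tendsto (fun x : ℝ => tricomiU 1 1 x + Real.log x) (𝓝[>] 0) (𝓝 C) := by
  have hreal : ∀ x : ℝ, 0 < x → tricomiU 1 1 x = ((tricomiU 1 1 x).re : ℂ) := by
    intro x hx
    obtain ⟨r, -, h⟩ := tricomiU_ofReal (a := 1) 1 zero_le_one hx
    simp only [Complex.ofReal_one] at h
    rw [h, Complex.ofReal_re]
  set g : ℝ → ℝ := fun x => Real.exp (-x) * (tricomiU 1 1 x).re + Real.log x with hg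
  have hderiv : ∀ x ∈ Ioi (0 : ℝ), HasDerivWithinAt g ((1 - Real.exp (-x)) / x) (Ioi 0) x := by
    intro x hx
    have hx' : (0 : ℝ) < x := hx
    have h1 : HasDerivAt (fun x => (tricomiU 1 1 x).re) ((tricomiU 1 1 x).re - x⁻¹) x := by
      have h : HasDerivAt (fun x => (tricomiU 1 1 x).re) (tricomiU 1 1 x - (x : ℂ)⁻¹).re x :=
        Complex.reCLM.hasFDerivAt.comp_hasDerivAt x (hasDerivAt_tricomiU_one_one hx')
      rwa [Complex.sub_re, ← Complex.ofReal_inv, Complex.ofReal_re] at h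
    have h2 := (((hasDerivAt_id x).fun_neg.exp).fun_mul h1).fun_add (Real.hasDerivAt_log hx'.ne')
    refine HasDerivAt.hasDerivWithinAt ?_
    convert! h2 using 1
    simp
    field_simp
    ring
  have hLip : LipschitzOnWith 1 g (Ioi 0) := by
    refine (convex_Ioi 0).lipschitzOnWith_of_nnnorm_hasDerivWithin_le hderiv fun x hx => ?_
    have hx' : (0 : ℝ) < x := hx
    rw [← NNReal.coe_le_coe, coe_nnnorm, Real.norm_of_nonneg, NNReal.coe_one, div_le_one hx']
    · linarith [Real.add_one_le_exp (-x)]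
    · refine div_nonneg ?_ hx'.le
      linarith [Real.exp_le_one_iff.2 (by linarith : -x ≤ 0)]
  obtain ⟨G, hG, hgG⟩ := hLip.extend_real
  refine ⟨G 0, ?_⟩
  have hglim : Tendsto (fun x => (g x : ℂ)) (𝓝[>] 0) (𝓝 (G 0 : ℂ)) := by
    refine (((Complex.continuous_ofReal.comp hG.continuous).tendsto 0).mono_left
      nhdsWithin_le_nhds).congr' ?_
    filter_upwards [self_mem_nhdsWithin] with x hx
    simp [hgG hx]
  have hexp : Tendsto (fun x : ℝ => (Real.exp x : ℂ)) (𝓝[>] 0) (𝓝 1) := by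
    have : ContinuousAt (fun x : ℝ => (Real.exp x : ℂ)) 0 := by fun_prop
    simpa using this.tendsto.mono_left (nhdsWithin_le_nhds (s := Ioi 0))
  have hslope : Tendsto (fun x : ℝ => (1 - (Real.exp x : ℂ)) * (x : ℂ)⁻¹) (𝓝[>] 0) (𝓝 (-1)) := by
    have h := ((hasDerivAt_iff_tendsto_slope.1 (Real.hasDerivAt_exp 0)).mono_left
      (nhdsWithin_mono 0 fun x hx => (ne_of_gt hx : x ≠ 0))).neg
    have h2 := (Complex.continuous_ofReal.tendsto _).comp h
    rw [Real.exp_zero] at h2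
    push_cast at h2
    refine h2.congr fun x => ?_
    simp [slope_def_field]
    ring
  have h := (hexp.mul hglim).add (hslope.mul tendsto_mul_log_nhdsGT_zero)
  rw [one_mul, mul_zero, add_zero] at h
  refine h.congr' ?_
  filter_upwards [self_mem_nhdsWithin] with x hx
  have hx' : (x : ℂ) ≠ 0 := by exact_mod_cast (ne_of_gt hx)
  rw [hreal x hx]
  have h3 : (Real.exp x : ℂ) * (Real.exp (-x) : ℂ) = 1 := by
    rw [← Complex.ofReal_mul, ← Real.exp_add]; simp
  simp only [hg]
  push_cast at h3 ⊢
  field_simp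
  linear_combination (((tricomiU 1 1 x).re : ℂ)) * h3

lemma add_natCast_ne_neg {a : ℂ} (ha : ∀ m : ℕ, a ≠ -m) (k : ℕ) : ∀ m : ℕ, a + k ≠ -m := by
  intro m h
  refine ha (m + k) ?_
  push_cast
  linear_combination h

lemma add_one_ne_neg {a : ℂ} (ha : ∀ m : ℕ, a ≠ -m) : ∀ m : ℕ, a + 1 ≠ -m := by
  simpa using add_natCast_ne_neg ha 1

/-- The leading behaviour `Γ(a) U(a, 1, x) = -log x - ψ(a) + C + o(1)`, for all `a` off the poles of
`Γ`. -/
lemma exists_tendsto_tricomiU_one :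
    ∃ C : ℝ, ∀ a : ℂ, (∀ m : ℕ, a ≠ -m) →
      Tendsto (fun x : ℝ => Complex.Gamma a * tricomiU a 1 x + Real.log x + Complex.digamma a)
        (𝓝[>] 0) (𝓝 C) := by
  obtain ⟨C, hC⟩ := exists_tendsto_tricomiU_one_one_add_log
  refine ⟨C - Real.eulerMascheroniConstant, fun a => ?_⟩
  induction a using induction_of_re_pos with
  | h₀ a ha =>
    intro _
    have h1 := tendsto_setIntegral_exp_mul (integrableOn_digammaKernel ha)
    rw [integral_digammaKernel ha] at h1
    have h2 := (h1.add hC).add_const (Complex.digamma a)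
    convert! h2.congr' ?_ using 1
    · congr 1
      push_cast
      ring
    filter_upwards [self_mem_nhdsWithin] with x hx
    have hx' : (0 : ℝ) < x := hx
    have hG := Complex.Gamma_ne_zero_of_re_pos ha
    have e1 : ∫ t in Ioi (0 : ℝ), Complex.exp (-(x * t : ℝ)) * digammaKernel a t
        = tricomiJ (a - 1) (-a) x - tricomiJ 0 (-1) x := by
      unfold tricomiJ
      rw [← MeasureTheory.integral_sub
        (integrableOn_tricomiKernel (-a) (by simp; linarith : -1 < (a - 1).re) hx')
        (integrableOn_tricomiKernel (-1) (by simp : -1 < (0 : ℂ).re) hx')]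
      refine MeasureTheory.integral_congr_ae (Eventually.of_forall fun t => ?_)
      simp only
      rw [tricomiKernel_eq_exp_mul (a - 1), tricomiKernel_eq_exp_mul 0, digammaKernel, mul_sub]
    have e2 : tricomiU 1 1 x = tricomiJ 0 (-1) x := by
      rw [tricomiU_eq_tricomiIntegral 1 hx' (by simp : 0 < (1 : ℂ).re), tricomiIntegral_eq]
      simp
    have e3 : Complex.Gamma a * tricomiU a 1 x = tricomiJ (a - 1) (-a) x := by
      rw [tricomiU_eq_tricomiIntegral 1 hx' ha, tricomiIntegral_eq, mul_inv_cancel_left₀ hG]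
      congr 1
      ring
    rw [e1, e2, e3]
    ring
  | h a h1 h2 =>
    intro ha
    have ha1 := add_one_ne_neg ha
    have ha2 : ∀ m : ℕ, a + 2 ≠ -m := by simpa using add_natCast_ne_neg ha 2
    have ha0 : a ≠ 0 := by simpa using ha 0
    have ha10 : a + 1 ≠ 0 := by simpa using ha1 0
    have d1 := Complex.digamma_apply_add_one a ha
    have d2 := Complex.digamma_apply_add_one (a + 1) ha1
    have g1 := Complex.Gamma_add_one a ha0
    have g2 := Complex.Gamma_add_one (a + 1) ha10
    rw [show a + 1 + 1 = a + 2 by ring] at d2 g2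
    have hl : Tendsto (fun x : ℝ => ((x : ℂ) + 2 * a + 1) / a) (𝓝[>] 0) (𝓝 ((0 + 2 * a + 1) / a)) :=
      ((tendsto_ofReal_nhdsGT_zero.add_const _).add_const _).div_const _
    have h3 := (((hl.mul (h1 ha1)).sub ((h2 ha2).const_mul ((a + 1) / a))).sub
      (tendsto_mul_log_nhdsGT_zero.div_const a)).sub
        (tendsto_ofReal_nhdsGT_zero.mul_const (Complex.digamma (a + 1) / a))
    convert! h3.congr' ?_ using 1
    · congr 1
      field_simp
      ring
    filter_upwards [self_mem_nhdsWithin] with x hx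
    rw [tricomiU_contiguous a 1 hx, g2, g1, d2, d1]
    field_simp
    ring

/-- `Γ(a + n) U(a, 1 - n, x) → Γ(n)` as `x → 0⁺`, for `n ≥ 1` and all `a` off the poles of
`Γ(a + n)`. -/
lemma tendsto_tricomiU_nhdsGT_zero {n : ℕ} (hn : 1 ≤ n) (a : ℂ) :
    (∀ m : ℕ, a + n ≠ -m) →
      Tendsto (fun x : ℝ => Complex.Gamma (a + n) * tricomiU a (1 - n) x) (𝓝[>] 0)
        (𝓝 (Complex.Gamma n)) := by
  induction a using induction_of_re_pos with
  | h₀ a ha =>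
    intro hne
    have hn' : 0 < (n : ℂ).re := by simpa using Nat.pos_of_ne_zero (by omega)
    have hG := Complex.Gamma_ne_zero_of_re_pos ha
    have hGn : Complex.Gamma (a + n) ≠ 0 := Complex.Gamma_ne_zero hne
    have h := (tendsto_tricomiJ_nhds_zero ha hn').const_mul
      (Complex.Gamma (a + n) * (Complex.Gamma a)⁻¹)
    convert! h.congr' ?_ using 1
    · congr 1
      field_simp
    filter_upwards [self_mem_nhdsWithin] with x hx
    rw [tricomiU_eq_tricomiIntegral _ hx ha, tricomiIntegral_eq, mul_assoc]
    congr 3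
    ring
  | h a h1 h2 =>
    intro hne
    rw [show a + 1 + (n : ℂ) = a + n + 1 by ring] at h1
    rw [show a + 2 + (n : ℂ) = a + n + 1 + 1 by ring] at h2
    have hne1 := add_one_ne_neg hne
    have h0 : a + n ≠ 0 := by simpa using hne 0
    have h10 : a + n + 1 ≠ 0 := by simpa using hne1 0
    have hl : Tendsto (fun x : ℝ => ((x : ℂ) + 2 * a + 1 + n) / (a + n)) (𝓝[>] 0)
        (𝓝 ((0 + 2 * a + 1 + n) / (a + n))) :=
      (((tendsto_ofReal_nhdsGT_zero.add_const _).add_const _).add_const _).div_const _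
    have h3 := (hl.mul (h1 hne1)).sub ((h2 (add_one_ne_neg hne1)).const_mul ((a + 1) / (a + n)))
    convert! h3.congr' ?_ using 1
    · congr 1
      field_simp
      ring
    filter_upwards [self_mem_nhdsWithin] with x hx
    rw [tricomiU_contiguous a _ hx, Complex.Gamma_add_one _ h10, Complex.Gamma_add_one _ h0]
    field_simp
    ring

/-- A function vanishing at `0⁺` whose derivative is `o(x^n)` is itself `o(x^{n+1})`. -/
lemma isLittleO_pow_succ_of_hasDerivAt {f f' : ℝ → ℂ} {n : ℕ}
    (hf : ∀ x, 0 < x → HasDerivAt f (f' x) x) (h0 : Tendsto f (𝓝[>] 0) (𝓝 0))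
    (hf' : f' =o[𝓝[>] 0] fun x : ℝ => x ^ n) : f =o[𝓝[>] 0] fun x : ℝ => x ^ (n + 1) := by
  rw [isLittleO_iff] at hf' ⊢
  intro c hc
  obtain ⟨δ, hδ, hb⟩ := (mem_nhdsGT_iff_exists_Ioo_subset).1 (hf' hc)
  filter_upwards [Ioo_mem_nhdsGT hδ] with x hx
  have hx0 : 0 < x := hx.1
  have hle : ∀ y ∈ Ioo 0 x, ‖f x - f y‖ ≤ c * x ^ n * ‖x - y‖ := by
    intro y hy
    refine (convex_Icc y x).norm_image_sub_le_of_norm_hasDerivWithin_le (f' := f')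
      (fun t ht => (hf t (lt_of_lt_of_le hy.1 ht.1)).hasDerivWithinAt) (fun t ht => ?_)
      (left_mem_Icc.2 hy.2.le) (right_mem_Icc.2 hy.2.le)
    have ht0 : 0 < t := lt_of_lt_of_le hy.1 ht.1
    have h1 : ‖f' t‖ ≤ c * ‖t ^ n‖ := hb ⟨ht0, lt_of_le_of_lt ht.2 hx.2⟩
    rw [Real.norm_of_nonneg (by positivity)] at h1
    refine h1.trans ?_
    have := ht.2
    gcongr
  have hlim1 : Tendsto (fun y => ‖f x - f y‖) (𝓝[>] 0) (𝓝 ‖f x - 0‖) := (h0.const_sub _).norm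
  have hlim2 : Tendsto (fun y => c * x ^ n * ‖x - y‖) (𝓝[>] 0) (𝓝 (c * x ^ n * ‖x - 0‖)) := by
    have : ContinuousAt (fun y => c * x ^ n * ‖x - y‖) 0 := by fun_prop
    exact this.tendsto.mono_left nhdsWithin_le_nhds
  have := le_of_tendsto_of_tendsto hlim1 hlim2 (by
    filter_upwards [Ioo_mem_nhdsGT hx0] with y hy using hle y hy)
  rw [sub_zero, sub_zero] at this
  rw [norm_pow, pow_succ, ← mul_assoc, ← norm_pow, Real.norm_of_nonneg (by positivity : 0 ≤ x ^ n)]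
  exact this

/-! ### The logarithmic expansion of `U(a, 1 - n, x)` -/

/-- The expansion `∑_{k < n} α_k x^k + β x^n (log x + γ)`. -/
noncomputable def logPoly (n : ℕ) (α : ℕ → ℂ) (β γ : ℂ) (x : ℝ) : ℂ :=
  ∑ k ∈ Finset.range n, α k * (x : ℂ) ^ k + β * (x : ℂ) ^ n * (Real.log x + γ)

lemma hasDerivAt_ofReal_pow (k : ℕ) (x : ℝ) :
    HasDerivAt (fun x : ℝ => (x : ℂ) ^ (k + 1)) ((k + 1) * (x : ℂ) ^ k) x := by
  have := (hasDerivAt_pow (k + 1) (x : ℂ)).comp_ofReal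
  simpa using this

lemma hasDerivAt_ofReal_log {x : ℝ} (hx : 0 < x) :
    HasDerivAt (fun x : ℝ => (Real.log x : ℂ)) ((x : ℂ)⁻¹) x := by
  have := (Real.hasDerivAt_log hx.ne').ofReal_comp
  rwa [Complex.ofReal_inv] at this

lemma hasDerivAt_logPoly_succ (n : ℕ) (α : ℕ → ℂ) (β γ : ℂ) {x : ℝ} (hx : 0 < x) :
    HasDerivAt (logPoly (n + 1) α β γ)
      (logPoly n (fun k => (k + 1) * α (k + 1)) ((n + 1) * β) (γ + 1 / (n + 1)) x) x := by
  have hx' : (x : ℂ) ≠ 0 := by exact_mod_cast hx.ne'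
  have hn : ((n : ℂ) + 1) ≠ 0 := by exact_mod_cast Nat.succ_ne_zero n
  have h1 : HasDerivAt (fun x : ℝ => ∑ k ∈ Finset.range n, α (k + 1) * (x : ℂ) ^ (k + 1))
      (∑ k ∈ Finset.range n, α (k + 1) * ((k + 1) * (x : ℂ) ^ k)) x :=
    HasDerivAt.fun_sum fun k _ => (hasDerivAt_ofReal_pow k x).const_mul _
  have h2 := ((hasDerivAt_ofReal_pow n x).const_mul β).fun_mul
    ((hasDerivAt_ofReal_log hx).add_const γ)
  have h3 := (h1.add_const (α 0 * (x : ℂ) ^ 0)).fun_add h2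
  unfold logPoly
  simp only [Finset.sum_range_succ' _ n, pow_zero, mul_one] at h3 ⊢
  convert! h3 using 1
  congr 1
  · exact Finset.sum_congr rfl fun k _ => by ring
  · field_simp
    ring

lemma tendsto_pow_succ_mul_log_add (n : ℕ) (γ : ℂ) :
    Tendsto (fun x : ℝ => (x : ℂ) ^ (n + 1) * ((Real.log x : ℂ) + γ)) (𝓝[>] 0) (𝓝 0) := by
  have h := (tendsto_ofReal_nhdsGT_zero.pow n).mul
    (tendsto_mul_log_nhdsGT_zero.add (tendsto_ofReal_nhdsGT_zero.mul_const γ))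
  rw [zero_mul, add_zero, mul_zero] at h
  refine h.congr fun x => ?_
  ring

lemma tendsto_sum_range_mul_pow (n : ℕ) (α : ℕ → ℂ) :
    Tendsto (fun x : ℝ => ∑ k ∈ Finset.range (n + 1), α k * (x : ℂ) ^ k) (𝓝[>] 0) (𝓝 (α 0)) := by
  have h : ContinuousAt (fun x : ℝ => ∑ k ∈ Finset.range (n + 1), α k * (x : ℂ) ^ k) 0 := by
    fun_prop
  have h2 := h.tendsto.mono_left (nhdsWithin_le_nhds (s := Ioi 0))
  simpa [Finset.sum_range_succ'] using h2

/-- Expansions may be integrated term by term. -/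
lemma isLittleO_sub_logPoly_succ {f f' : ℝ → ℂ} {n : ℕ} {α : ℕ → ℂ} {β γ : ℂ}
    (hf : ∀ x, 0 < x → HasDerivAt f (f' x) x) (h0 : Tendsto f (𝓝[>] 0) (𝓝 (α 0)))
    (hf' : (fun x => f' x - logPoly n (fun k => (k + 1) * α (k + 1)) ((n + 1) * β)
      (γ + 1 / (n + 1)) x) =o[𝓝[>] 0] fun x : ℝ => x ^ n) :
    (fun x => f x - logPoly (n + 1) α β γ x) =o[𝓝[>] 0] fun x : ℝ => x ^ (n + 1) := by
  refine isLittleO_pow_succ_of_hasDerivAt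
    (fun x hx => (hf x hx).fun_sub (hasDerivAt_logPoly_succ n α β γ hx)) ?_ hf'
  have h := h0.sub ((tendsto_sum_range_mul_pow n α).add
    ((tendsto_pow_succ_mul_log_add n γ).const_mul β))
  rw [mul_zero, add_zero, sub_self] at h
  refine h.congr fun x => ?_
  unfold logPoly
  ring

/-- The coefficient `(-1)^{n+1} (a)_n / n!` of `x^n log x` in `Γ(a + n) U(a, 1 - n, x)`, as a
polynomial in `a`. -/
noncomputable def logCoeff (n : ℕ) : Polynomial ℝ :=
  Polynomial.C ((-1) ^ (n + 1) / (n.factorial : ℝ)) * ascPochhammer ℝ n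

lemma succ_mul_aeval_logCoeff_succ (n : ℕ) (a : ℂ) :
    ((n : ℂ) + 1) * Polynomial.aeval a (logCoeff (n + 1))
      = -a * Polynomial.aeval (a + 1) (logCoeff n) := by
  have hn : ((n : ℂ) + 1) ≠ 0 := by exact_mod_cast Nat.succ_ne_zero n
  have hf : (n.factorial : ℂ) ≠ 0 := by exact_mod_cast n.factorial_ne_zero
  unfold logCoeff
  rw [ascPochhammer_succ_left]
  simp only [map_mul, Polynomial.aeval_C, Polynomial.aeval_X, Polynomial.aeval_comp, map_add,
    map_one, Nat.factorial_succ, Complex.coe_algebraMap]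
  push_cast
  field_simp
  ring

/-- The logarithmic expansion of `Γ(a + n) U(a, 1 - n, x)` and of its Euler derivative `x ∂_x`
(for `n ≥ 1`). All coefficients are real polynomials in `a`, apart from `ψ(a + n)`. -/
def HasTricomiExpansion (n : ℕ) (u : ℕ → Polynomial ℝ) (C : ℝ) : Prop :=
  ∀ a : ℂ, (∀ m : ℕ, a + n ≠ -m) →
    (fun x : ℝ => Complex.Gamma (a + n) * tricomiU a (1 - n) x
      - logPoly n (fun k => Polynomial.aeval a (u k)) (Polynomial.aeval a (logCoeff n))
        (Complex.digamma (a + n) + C) x) =o[𝓝[>] 0] (fun x : ℝ => x ^ n) ∧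
    (1 ≤ n → (fun x : ℝ => x * (Complex.Gamma (a + n) * (-a * tricomiU (a + 1) (1 - n + 1) x))
      - (∑ k ∈ Finset.range n, k * Polynomial.aeval a (u k) * (x : ℂ) ^ k
        + Polynomial.aeval a (logCoeff n) * (x : ℂ) ^ n *
          (n * (Real.log x + (Complex.digamma (a + n) + C)) + 1)))
        =o[𝓝[>] 0] (fun x : ℝ => x ^ n))

lemma exists_hasTricomiExpansion_zero :
    ∃ (u : ℕ → Polynomial ℝ) (C : ℝ), HasTricomiExpansion 0 u C := by
  obtain ⟨C, hC⟩ := exists_tendsto_tricomiU_one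
  refine ⟨0, -C, fun a ha => ⟨?_, fun h => absurd h (by norm_num)⟩⟩
  simp only [Nat.cast_zero, add_zero] at ha
  have h := (hC a ha).sub_const (C : ℂ)
  rw [sub_self] at h
  simp only [pow_zero]
  rw [isLittleO_one_iff]
  refine h.congr fun x => ?_
  simp [logPoly, logCoeff]
  ring

/-- The expansion for `n + 1` is the integral of the one for `n`, since
`∂_x U(a, -n, x) = -a U(a + 1, 1 - n, x)`. -/
lemma HasTricomiExpansion.succ {n : ℕ} {u : ℕ → Polynomial ℝ} {C : ℝ}
    (h : HasTricomiExpansion n u C) :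
    ∃ (u' : ℕ → Polynomial ℝ) (C' : ℝ), u' 0 = Polynomial.C (Real.Gamma (n + 1)) ∧
      HasTricomiExpansion (n + 1) u' C' := by
  have hn : ((n : ℂ) + 1) ≠ 0 := by exact_mod_cast Nat.succ_ne_zero n
  set u' : ℕ → Polynomial ℝ := fun k => Nat.casesOn k (Polynomial.C (Real.Gamma (n + 1)))
    (fun k => -Polynomial.X * ((u k).comp (Polynomial.X + 1)) *
      Polynomial.C (((k : ℝ) + 1)⁻¹)) with hu'
  have hu'_succ : ∀ (a : ℂ) (k : ℕ), ((k : ℂ) + 1) * Polynomial.aeval a (u' (k + 1))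
      = -a * Polynomial.aeval (a + 1) (u k) := by
    intro a k
    have hk : ((k : ℂ) + 1) ≠ 0 := by exact_mod_cast Nat.succ_ne_zero k
    simp only [hu', map_mul, map_neg, Polynomial.aeval_X, Polynomial.aeval_comp, map_add, map_one,
      Polynomial.aeval_C, Complex.coe_algebraMap]
    push_cast
    field_simp
  refine ⟨u', C - 1 / (n + 1), rfl, fun a ha => ?_⟩
  have hcast : (((n + 1 : ℕ) : ℂ)) = n + 1 := by push_cast; ring
  have ha' : ∀ m : ℕ, a + 1 + n ≠ -m := by
    intro m hm
    refine ha m ?_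
    rw [hcast, ← hm]
    ring
  have hψ : a + ((n + 1 : ℕ) : ℂ) = a + 1 + n := by rw [hcast]; ring
  have hb : (1 : ℂ) - ((n + 1 : ℕ) : ℂ) + 1 = 1 - n := by rw [hcast]; ring
  have h1 := (h (a + 1) ha').1
  have hlog : (fun x : ℝ => Complex.Gamma (a + 1 + n) * (-a * tricomiU (a + 1) (1 - n) x)
      - logPoly n (fun k => (k + 1) * Polynomial.aeval a (u' (k + 1)))
        ((n + 1) * Polynomial.aeval a (logCoeff (n + 1)))
        (Complex.digamma (a + 1 + n) + C) x) =o[𝓝[>] 0] fun x : ℝ => x ^ n := by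
    refine (h1.const_mul_left (-a)).congr_left fun x => ?_
    simp only [logPoly, hu'_succ, succ_mul_aeval_logCoeff_succ, mul_sub, mul_add, Finset.mul_sum]
    congr 1
    · ring
    · congr 1
      · exact Finset.sum_congr rfl fun k _ => by ring
      · ring
  have hC' : ((C - 1 / (n + 1) : ℝ) : ℂ) = C - 1 / (n + 1) := by push_cast; ring
  constructor
  · refine isLittleO_sub_logPoly_succ
      (f' := fun x => Complex.Gamma (a + 1 + n) * (-a * tricomiU (a + 1) (1 - n) x))
      (fun x hx => ?_) ?_ ?_
    · have := (hasDerivAt_tricomiU a (1 - ((n + 1 : ℕ) : ℂ)) hx).const_mul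
        (Complex.Gamma (a + ((n + 1 : ℕ) : ℂ)))
      rw [hb, hψ] at this
      rwa [hψ]
    · have := tendsto_tricomiU_nhdsGT_zero (Nat.le_add_left 1 n) a ha
      convert! this using 1
      change 𝓝 (Polynomial.aeval a (Polynomial.C (Real.Gamma (n + 1)))) = _
      rw [Polynomial.aeval_C, Complex.coe_algebraMap, hcast, ← Complex.Gamma_ofReal]
      push_cast
      rfl
    · refine hlog.congr_left fun x => ?_
      rw [hψ, hC']
      congr 2
      ring
  · intro _
    rw [hψ, hb]
    have h2 : (fun x : ℝ => (x : ℂ)) =O[𝓝[>] 0] (fun x : ℝ => x) :=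
      IsBigO.of_bound 1 (Eventually.of_forall fun x => by simp)
    refine ((h2.mul_isLittleO hlog).congr_left fun x => ?_).congr_right fun x => ?_
    · rw [Finset.sum_range_succ', hC', hcast]
      simp only [logPoly, mul_sub, mul_add, Finset.mul_sum]
      congr 1
      simp only [Nat.cast_zero, zero_mul, add_zero]
      congr 1
      · refine Finset.sum_congr rfl fun k _ => ?_
        push_cast
        ring
      · field_simp
        ring
    · ring

lemma exists_hasTricomiExpansion_succ (n : ℕ) :
    ∃ (u : ℕ → Polynomial ℝ) (C : ℝ), u 0 = Polynomial.C (Real.Gamma (n + 1)) ∧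
      HasTricomiExpansion (n + 1) u C := by
  induction n with
  | zero =>
    obtain ⟨u, C, h⟩ := exists_hasTricomiExpansion_zero
    exact_mod_cast h.succ
  | succ n ih =>
    obtain ⟨u, C, -, h⟩ := ih
    exact_mod_cast h.succ

/-! ### The expansion of the quotient -/

/-- Long division by increasing powers. -/
lemma exists_eq_sum_mul_add_X_pow_mul {S : Type*} [CommRing S] (P D : Polynomial S) {e : S}
    (he : e * P.coeff 0 = 1) (m : ℕ) : ∃ (q : ℕ → S) (r : Polynomial S),
      D = (∑ k ∈ Finset.range m, Polynomial.C (q k) * Polynomial.X ^ k) * P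
        + Polynomial.X ^ m * r := by
  induction m with
  | zero => exact ⟨0, D, by simp⟩
  | succ m ih =>
    obtain ⟨q, r, h⟩ := ih
    have h0 : (r - Polynomial.C (e * r.coeff 0) * P).coeff 0 = 0 := by
      simp only [Polynomial.coeff_sub, Polynomial.coeff_C_mul]
      linear_combination -r.coeff 0 * he
    obtain ⟨r', hr'⟩ := Polynomial.X_dvd_iff.2 h0
    refine ⟨Function.update q m (e * r.coeff 0), r', ?_⟩
    have hs : ∑ k ∈ Finset.range m,
        Polynomial.C (Function.update q m (e * r.coeff 0) k) * Polynomial.X ^ k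
        = ∑ k ∈ Finset.range m, Polynomial.C (q k) * Polynomial.X ^ k :=
      Finset.sum_congr rfl fun k hk => by
        rw [Function.update_of_ne (Finset.mem_range.1 hk).ne]
    rw [Finset.sum_range_succ, hs, Function.update_self, pow_succ, mul_assoc, ← hr']
    linear_combination h

lemma tendsto_mul_log_sq_nhdsGT_zero :
    Tendsto (fun x : ℝ => (x : ℂ) * (Real.log x : ℂ) ^ 2) (𝓝[>] 0) (𝓝 0) := by
  have h := (tendsto_log_mul_rpow_nhdsGT_zero (r := 1 / 2) (by norm_num)).pow 2
  have h2 := (Complex.continuous_ofReal.tendsto _).comp h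
  rw [zero_pow two_ne_zero, Complex.ofReal_zero] at h2
  refine h2.congr' ?_
  filter_upwards [self_mem_nhdsWithin] with x hx
  have hx' : (0 : ℝ) < x := hx
  rw [Function.comp, mul_pow, ← Real.sqrt_eq_rpow, Real.sq_sqrt hx'.le]
  push_cast
  ring

lemma isLittleO_pow_iff_tendsto {f : ℝ → ℂ} {n : ℕ} :
    f =o[𝓝[>] 0] (fun x : ℝ => x ^ n) ↔
      Tendsto (fun x : ℝ => f x / (x : ℂ) ^ n) (𝓝[>] 0) (𝓝 0) := by
  have h : (fun x : ℝ => (x : ℂ) ^ n) =Θ[𝓝[>] 0] fun x : ℝ => x ^ n :=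
    IsTheta.of_norm_eventuallyEq_norm (Eventually.of_forall fun x => by simp)
  rw [← h.isLittleO_congr_right]
  refine isLittleO_iff_tendsto' ?_
  filter_upwards [self_mem_nhdsWithin] with x hx h0
  have hx' : (x : ℂ) ≠ 0 := by exact_mod_cast (ne_of_gt hx)
  exact absurd h0 (pow_ne_zero _ hx')

/-- The quotient of two logarithmic expansions, the numerator being the Euler derivative of the
denominator. -/
lemma isLittleO_quotient {n : ℕ} (hn : 1 ≤ n) {N D r : ℝ → ℂ} {u q : ℕ → ℂ} {v γ r₀ : ℂ}
    (hu : u 0 ≠ 0) (hq : q 0 = 0) (hr : Tendsto r (𝓝[>] 0) (𝓝 r₀))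
    (hN : (fun x => N x - logPoly n u v γ x) =o[𝓝[>] 0] fun x : ℝ => x ^ n)
    (hD : (fun x : ℝ => D x - (∑ k ∈ Finset.range n, k * u k * (x : ℂ) ^ k
      + v * (x : ℂ) ^ n * (n * (Real.log x + γ) + 1))) =o[𝓝[>] 0] fun x : ℝ => x ^ n)
    (hdiv : ∀ x : ℝ, ∑ k ∈ Finset.range n, k * u k * (x : ℂ) ^ k
      = (∑ k ∈ Finset.range (n + 1), q k * (x : ℂ) ^ k) * (∑ k ∈ Finset.range n, u k * (x : ℂ) ^ k)
        + (x : ℂ) ^ (n + 1) * r x) :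
    (fun x : ℝ => D x / N x - (∑ k ∈ Finset.range (n + 1), q k * (x : ℂ) ^ k
      + v / u 0 * (x : ℂ) ^ n * (n * (Real.log x + γ) + 1))) =o[𝓝[>] 0] fun x : ℝ => x ^ n := by
  obtain ⟨m, rfl⟩ : ∃ m, n = m + 1 := ⟨n - 1, by omega⟩
  rw [isLittleO_pow_iff_tendsto] at hN hD ⊢
  have tX := tendsto_ofReal_nhdsGT_zero
  have tL := tendsto_mul_log_nhdsGT_zero
  set ρ₀ : ℝ → ℂ := fun x => (N x - logPoly (m + 1) u v γ x) / (x : ℂ) ^ (m + 1) with hρ₀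
  set ρ₁ : ℝ → ℂ := fun x => (D x - (∑ k ∈ Finset.range (m + 1), k * u k * (x : ℂ) ^ k
      + v * (x : ℂ) ^ (m + 1) * ((m + 1 : ℕ) * (Real.log x + γ) + 1))) / (x : ℂ) ^ (m + 1) with hρ₁
  set Q : ℝ → ℂ := fun x => ∑ k ∈ Finset.range (m + 1), q (k + 1) * (x : ℂ) ^ k with hQ
  set W : ℝ → ℂ := fun x => ∑ k ∈ Finset.range m, u (k + 1) * (x : ℂ) ^ k with hW
  have tQ : Tendsto Q (𝓝[>] 0) (𝓝 (q 1)) := tendsto_sum_range_mul_pow m fun k => q (k + 1)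
  have tW : Tendsto W (𝓝[>] 0) (𝓝 (W 0)) := by
    have : ContinuousAt W 0 := by rw [hW]; fun_prop
    exact this.tendsto.mono_left nhdsWithin_le_nhds
  -- `x L₀`, `x L₁` and `x L₀ L₁` tend to `0`, where `L₀ = log x + γ` and `L₁ = n L₀ + 1`
  have tL0 : Tendsto (fun x : ℝ => (x : ℂ) * (Real.log x + γ)) (𝓝[>] 0) (𝓝 0) := by
    have h := tL.add (tX.mul_const γ)
    rw [zero_mul, add_zero] at h
    exact h.congr fun x => by ring
  have tL1 : Tendsto (fun x : ℝ => (x : ℂ) * (((m + 1 : ℕ) : ℂ) * (Real.log x + γ) + 1)) (𝓝[>] 0)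
      (𝓝 0) := by
    have h := (tL0.const_mul ((m + 1 : ℕ) : ℂ)).add tX
    rw [mul_zero, add_zero] at h
    exact h.congr fun x => by ring
  have tLL : Tendsto (fun x : ℝ => (x : ℂ) * (((m + 1 : ℕ) : ℂ) * (Real.log x + γ) + 1)
      * (Real.log x + γ)) (𝓝[>] 0) (𝓝 0) := by
    have h := ((tendsto_mul_log_sq_nhdsGT_zero.const_mul ((m + 1 : ℕ) : ℂ)).add
      (tL.mul_const (2 * ((m + 1 : ℕ) : ℂ) * γ + 1))).add
      (tX.mul_const (((m + 1 : ℕ) : ℂ) * γ ^ 2 + γ))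
    simp only [mul_zero, zero_mul, add_zero] at h
    exact h.congr fun x => by ring
  have eN : ∀ᶠ x : ℝ in 𝓝[>] 0, N x = u 0 + x * (W x + (x : ℂ) ^ m * (v * (Real.log x + γ) + ρ₀ x)) := by
    filter_upwards [self_mem_nhdsWithin] with x hx
    have hx' : (x : ℂ) ≠ 0 := by exact_mod_cast (ne_of_gt hx)
    have h1 : ρ₀ x * (x : ℂ) ^ (m + 1) = N x - logPoly (m + 1) u v γ x :=
      div_mul_cancel₀ _ (pow_ne_zero _ hx')
    have h2 : ∑ k ∈ Finset.range m, u (k + 1) * (x : ℂ) ^ (k + 1) = x * W x := by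
      rw [hW]
      simp only
      rw [Finset.mul_sum]
      exact Finset.sum_congr rfl fun k _ => by ring
    rw [logPoly, Finset.sum_range_succ', h2] at h1
    linear_combination -h1
  have tN : Tendsto N (𝓝[>] 0) (𝓝 (u 0)) := by
    have h := ((tX.mul tW).add ((tX.pow m).mul ((tL0.const_mul v).add (tX.mul hN)))).const_add (u 0)
    simp only [mul_zero, zero_mul, add_zero] at h
    refine h.congr' ?_
    filter_upwards [eN] with x hx
    rw [hx]
    ring
  have hmain := ((((tX.mul hr).add hD).sub
    ((tQ.mul tL0).mul_const v)).sub ((tX.mul tQ).mul hN)).sub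
    ((((tL1.mul tW).add ((tX.pow m).mul ((tLL.const_mul v).add (tL1.mul hN)))).const_mul
      (v / u 0)))
  simp only [mul_zero, zero_mul, add_zero, sub_zero] at hmain
  have hfin := hmain.div tN hu
  rw [zero_div] at hfin
  refine hfin.congr' ?_
  filter_upwards [self_mem_nhdsWithin, eN, tN.eventually_ne hu] with x hx hNx hN0
  have hx' : (x : ℂ) ≠ 0 := by exact_mod_cast (ne_of_gt hx)
  have hxm : (x : ℂ) ^ m ≠ 0 := pow_ne_zero _ hx'
  have h1 : ρ₁ x * (x : ℂ) ^ (m + 1) = _ := div_mul_cancel₀ _ (pow_ne_zero _ hx')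
  have h0 : ρ₀ x * (x : ℂ) ^ (m + 1) = _ := div_mul_cancel₀ _ (pow_ne_zero _ hx')
  have hqQ : ∑ k ∈ Finset.range (m + 1 + 1), q k * (x : ℂ) ^ k = x * Q x := by
    rw [Finset.sum_range_succ', hq, zero_mul, add_zero, hQ]
    simp only
    rw [Finset.mul_sum]
    exact Finset.sum_congr rfl fun k _ => by ring
  have hdx := hdiv x
  rw [hdx] at h1
  rw [hqQ] at h1 ⊢
  rw [logPoly] at h0
  simp only [Pi.div_apply]
  generalize ρ₀ x = R0 at *
  generalize ρ₁ x = R1 at *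
  generalize Q x = q' at *
  generalize W x = w' at *
  generalize (Real.log x : ℂ) = l at *
  generalize (∑ k ∈ Finset.range (m + 1), u k * (x : ℂ) ^ k) = P at *
  generalize N x = N' at *
  generalize D x = D' at *
  generalize r x = r' at *
  rw [pow_succ] at h0 h1 ⊢
  rw [pow_succ, pow_succ] at h1
  have hk : v / u 0 * u 0 = v := div_mul_cancel₀ _ hu
  generalize v / u 0 = k at *
  rw [div_eq_div_iff hN0 (mul_ne_zero hxm hx')]
  have hDN : ∀ T : ℂ, (D' / N' - T) * N' = D' - T * N' := fun T => by field_simp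
  rw [hDN]
  linear_combination h1 - x * q' * h0
    + (((m + 1 : ℕ) : ℂ) * (l + γ) + 1) * ((x : ℂ) ^ m * x) * (k * hNx + hk)

/-- The quotient `x ∂_x U / U` at `b = 1 - n` has an expansion whose coefficients are real polynomials
in `a`, apart from `ψ(a + n)` in the coefficient of `x^n`. -/
lemma exists_isLittleO_tricomiU_quotient {n : ℕ} (hn : 1 ≤ n) :
    ∃ (q : ℕ → Polynomial ℝ) (C : ℝ), q 0 = 0 ∧ ∀ a : ℂ, (∀ m : ℕ, a + n ≠ -m) →
      (fun x : ℝ => x * (-a * tricomiU (a + 1) (1 - n + 1) x) / tricomiU a (1 - n) x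
        - (∑ k ∈ Finset.range (n + 1), Polynomial.aeval a (q k) * (x : ℂ) ^ k
          + Polynomial.aeval a (logCoeff n) / Complex.Gamma n * (x : ℂ) ^ n *
            (n * (Real.log x + (Complex.digamma (a + n) + C)) + 1)))
        =o[𝓝[>] 0] (fun x : ℝ => x ^ n) := by
  obtain ⟨m, rfl⟩ : ∃ m, n = m + 1 := ⟨n - 1, by omega⟩
  obtain ⟨u, C, hu0, hexp⟩ := exists_hasTricomiExpansion_succ m
  have hG : Real.Gamma (m + 1) ≠ 0 := (Real.Gamma_pos_of_pos (by positivity)).ne'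
  have hGc : Complex.Gamma ((m + 1 : ℕ) : ℂ) = (Real.Gamma (m + 1) : ℂ) := by
    rw [← Complex.Gamma_ofReal]; push_cast; rfl
  set P : Polynomial (Polynomial ℝ) :=
    ∑ k ∈ Finset.range (m + 1), Polynomial.C (u k) * Polynomial.X ^ k with hP
  set D : Polynomial (Polynomial ℝ) :=
    ∑ k ∈ Finset.range (m + 1), Polynomial.C ((k : Polynomial ℝ) * u k) * Polynomial.X ^ k with hD
  have hP0 : P.coeff 0 = u 0 := by
    rw [hP, Finset.sum_range_succ']
    simp
  have hD0 : D.coeff 0 = 0 := by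
    rw [hD, Finset.sum_range_succ']
    simp
  have he : Polynomial.C ((Real.Gamma (m + 1))⁻¹) * P.coeff 0 = 1 := by
    rw [hP0, hu0, ← Polynomial.C_mul, inv_mul_cancel₀ hG, Polynomial.C_1]
  obtain ⟨q, r, hqr⟩ := exists_eq_sum_mul_add_X_pow_mul P D he (m + 2)
  have hq0 : q 0 = 0 := by
    have h := congrArg (fun p => Polynomial.coeff p 0) hqr
    simp only [Polynomial.coeff_add, Polynomial.mul_coeff_zero, hD0, hP0,
      Polynomial.finsetSum_coeff] at h
    rw [Finset.sum_range_succ'] at h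
    simp only [Polynomial.coeff_X_pow] at h
    simp [hu0, hG] at h
    exact h
  refine ⟨q, C, hq0, fun a ha => ?_⟩
  obtain ⟨h1, h2⟩ := hexp a ha
  have hGa := Complex.Gamma_ne_zero ha
  have hu0' : Polynomial.aeval a (u 0) = Complex.Gamma ((m + 1 : ℕ) : ℂ) := by
    rw [hu0, Polynomial.aeval_C, hGc]; rfl
  have hdiv : ∀ x : ℝ, ∑ k ∈ Finset.range (m + 1), k * Polynomial.aeval a (u k) * (x : ℂ) ^ k
      = (∑ k ∈ Finset.range (m + 1 + 1), Polynomial.aeval a (q k) * (x : ℂ) ^ k)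
        * (∑ k ∈ Finset.range (m + 1), Polynomial.aeval a (u k) * (x : ℂ) ^ k)
        + (x : ℂ) ^ (m + 1 + 1) * r.eval₂ (Polynomial.aeval a).toRingHom (x : ℂ) := by
    intro x
    have h := congrArg (Polynomial.eval₂RingHom (Polynomial.aeval a).toRingHom (x : ℂ)) hqr
    rw [hD, hP] at h
    simpa [Polynomial.eval₂_finsetSum] using h
  have hr : Tendsto (fun x : ℝ => r.eval₂ (Polynomial.aeval a).toRingHom (x : ℂ)) (𝓝[>] 0)
      (𝓝 (r.eval₂ (Polynomial.aeval a).toRingHom ((0 : ℝ) : ℂ))) := by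
    have h : Continuous fun x : ℝ => r.eval₂ (Polynomial.aeval a).toRingHom (x : ℂ) := by
      simp only [Polynomial.eval₂_eq_eval_map]
      fun_prop
    exact (h.tendsto 0).mono_left nhdsWithin_le_nhds
  have h := isLittleO_quotient hn (q := fun k => Polynomial.aeval a (q k))
    (by rw [hu0', hGc]; exact_mod_cast hG) (by simp [hq0]) hr h1 (h2 hn) hdiv
  refine h.congr_left fun x => ?_
  rw [hu0', mul_left_comm (x : ℂ) (Complex.Gamma _), mul_div_mul_left _ _ hGa]

/-! ### The renormalized response function in even dimension -/

lemma aeval_ascPochhammer {n : ℕ} {a : ℂ} (ha : ∀ m : ℕ, a + n ≠ -m) :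
    Complex.Gamma (a + n) / Complex.Gamma a = Polynomial.aeval a (ascPochhammer ℝ n) := by
  have h : Polynomial.aeval a (ascPochhammer ℝ n) = (ascPochhammer ℂ n).eval a := by
    rw [Polynomial.aeval_def, Polynomial.eval₂_eq_eval_map, ascPochhammer_map]
  rw [h]
  by_cases h0 : ∀ m : ℕ, a ≠ -m
  · exact Complex.Gamma_add_nat_div_Gamma_eq a h0
  · push Not at h0
    obtain ⟨m, rfl⟩ := h0
    have hm : m < n := by
      by_contra! hmn
      refine ha (m - n) ?_
      push_cast [Nat.cast_sub hmn]
      ring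
    rw [Complex.Gamma_neg_nat_eq_zero, div_zero, ascPochhammer_eval_neg_coe_nat_of_lt hm]

section Even

variable {n : ℕ} {Λ : ℝ}

/-- The factor `-2 ((d-1)/2)^n n / Γ(n)` with `d = 2n`, by which `logCoeff n` enters the coefficient
of `w^d ψ(a + n)` in the response `-2 x ∂_x U / U`, `x = (d-1) w² / 2`. -/
noncomputable def responseFactor (n : ℕ) : ℝ :=
  -2 * (((n + n : ℕ) - 1 : ℝ) / 2) ^ n * n / Real.Gamma n

lemma EhatFormula_eq (hn : 1 ≤ n) (s : ℂ) (hs : ∀ m : ℕ, momentumParam (n + n) Λ s + n ≠ -m) :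
    EhatFormula (n + n) Λ s = responseFactor n *
      Polynomial.aeval (momentumParam (n + n) Λ s) (logCoeff n) *
        Complex.digamma (momentumParam (n + n) Λ s + n) := by
  have hhalf : (n + n) / 2 = n := by omega
  have hhalf' : ((n + n : ℕ) : ℂ) / 2 = n := by push_cast; ring
  have hasc := aeval_ascPochhammer hs
  have hΓ : Complex.Gamma n = (Real.Gamma n : ℂ) := by rw [← Complex.Gamma_ofReal]; push_cast; rfl
  have hG : (Real.Gamma n : ℂ) ≠ 0 := by
    exact_mod_cast (Real.Gamma_pos_of_pos (by exact_mod_cast hn)).ne'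
  have hfac : (n.factorial : ℂ) = n * Real.Gamma n := by
    rw [← Complex.Gamma_nat_eq_factorial, Complex.Gamma_add_one _ (by exact_mod_cast (by omega)), hΓ]
  unfold EhatFormula responseFactor logCoeff
  rw [hhalf, hhalf', add_comm (n : ℂ), map_mul, Polynomial.aeval_C, ← hasc, hΓ]
  have hn0 : (n : ℂ) ≠ 0 := by exact_mod_cast (by omega)
  simp only [Complex.coe_algebraMap]
  push_cast
  rw [hfac]
  field_simp
  ring

lemma momentumParam_add_ne (hΛ : 0 < Λ) {s : ℂ} :
    s ∉ linearSpectrum (n + n) Λ ↔ ∀ m : ℕ, momentumParam (n + n) Λ s + n ≠ -m := by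
  have hhalf : (n + n) / 2 = n := by omega
  have h1 : (((n + n : ℕ) : ℂ) - 1) ≠ 0 := by
    rw [sub_ne_zero]; norm_cast; omega
  have h2 : (Λ : ℂ) ≠ 0 := by exact_mod_cast hΛ.ne'
  have hiff : ∀ z : ℂ, momentumParam (n + n) Λ s = -z ↔
      s = -(2 * (((n + n : ℕ) : ℂ) - 1) * (Λ : ℂ) ^ 2 * z) := by
    intro z
    unfold momentumParam
    rw [div_eq_iff (mul_ne_zero (mul_ne_zero two_ne_zero h1) (pow_ne_zero _ h2))]
    constructor <;> intro h <;> rw [h] <;> ring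
  unfold linearSpectrum
  rw [hhalf]
  constructor
  · intro h m hm
    refine h ⟨n + m, by omega, (hiff _).1 ?_⟩
    push_cast
    linear_combination hm
  · rintro h ⟨m, hm, hs⟩
    refine h (m - n) ?_
    rw [(hiff m).2 hs]
    push_cast [Nat.cast_sub hm]
    ring

lemma tendsto_tensorMode_arg (hn : 1 ≤ n) :
    Tendsto (fun w : ℝ => (((n + n : ℕ) : ℝ) - 1) / 2 * w ^ 2) (𝓝[>] 0) (𝓝[>] 0) := by
  rw [tendsto_nhdsWithin_iff]
  constructor
  · have : ContinuousAt (fun w : ℝ => (((n + n : ℕ) : ℝ) - 1) / 2 * w ^ 2) 0 := by fun_prop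
    simpa using this.tendsto.mono_left (nhdsWithin_le_nhds (s := Ioi 0))
  · filter_upwards [self_mem_nhdsWithin] with w hw
    exact tensorMode_arg_pos (by omega) hw

lemma eventually_tensorMode_ne_zero (hn : 1 ≤ n) (hΛ : 0 < Λ) {s : ℂ}
    (hs : s ∉ linearSpectrum (n + n) Λ) :
    ∀ᶠ w in 𝓝[>] (0 : ℝ), tensorMode (n + n) Λ s w ≠ 0 := by
  have hs' := (momentumParam_add_ne hΛ).1 hs
  have h := (tendsto_tricomiU_nhdsGT_zero hn _ hs').comp (tendsto_tensorMode_arg hn)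
  have hG : Complex.Gamma n ≠ 0 :=
    Complex.Gamma_ne_zero_of_re_pos (by simpa using Nat.pos_of_ne_zero (by omega))
  filter_upwards [h.eventually_ne hG] with w hw
  have hw' := right_ne_zero_of_mul hw
  unfold tensorMode
  rw [show ((n + n : ℕ) : ℂ) / 2 = n by push_cast; ring]
  exact hw'

lemma isNonanalyticRenormalizedPart_EhatFormula (hn : 1 ≤ n) (hΛ : 0 < Λ) :
    IsNonanalyticRenormalizedPart (n + n) (linearSpectrum (n + n) Λ)ᶜ (tricomiResponse (n + n) Λ)
      (EhatFormula (n + n) Λ) := by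
  obtain ⟨q, C, hq0, hq⟩ := exists_isLittleO_tricomiU_quotient hn
  have hhalf : (n + n) / 2 = n := by omega
  have hhalf' : ((n + n : ℕ) : ℂ) / 2 = n := by push_cast; ring
  set κ : ℝ := (((n + n : ℕ) : ℝ) - 1) / 2 with hκ
  have hκ0 : 0 < κ := by
    have : (1 : ℝ) ≤ n := by exact_mod_cast hn
    rw [hκ]; push_cast; linarith
  set τ : ℝ := 1 / (2 * (((n + n : ℕ) : ℝ) - 1) * Λ ^ 2) with hτ
  have hcomp : ∀ (p : Polynomial ℝ) (s : ℂ),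
      Polynomial.aeval s (p.comp (Polynomial.C τ * Polynomial.X))
        = Polynomial.aeval (momentumParam (n + n) Λ s) p := by
    intro p s
    rw [Polynomial.aeval_comp]
    congr 2
    simp only [map_mul, Polynomial.aeval_C, Polynomial.aeval_X, Complex.coe_algebraMap, hτ,
      momentumParam]
    push_cast
    ring
  have hΓ : Complex.Gamma n = (Real.Gamma n : ℂ) := by rw [← Complex.Gamma_ofReal]; push_cast; rfl
  refine ⟨fun k => Polynomial.C (-2 * κ ^ k) * (q k).comp (Polynomial.C τ * Polynomial.X),
    Polynomial.C (responseFactor n) * (logCoeff n).comp (Polynomial.C τ * Polynomial.X),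
    Polynomial.C (-2 * κ ^ n) * (q n).comp (Polynomial.C τ * Polynomial.X)
      + Polynomial.C (responseFactor n * (Real.log κ + C) - 2 * κ ^ n / Real.Gamma n)
        * (logCoeff n).comp (Polynomial.C τ * Polynomial.X), fun s hs => ?_⟩
  have hs' := (momentumParam_add_ne hΛ).1 hs
  have h := ((hq _ hs').comp_tendsto (tendsto_tensorMode_arg hn)).const_mul_left (-2)
  have hO : ((fun x : ℝ => x ^ n) ∘ fun w : ℝ => κ * w ^ 2) =O[𝓝[>] 0] fun w : ℝ => w ^ (n + n) := by
    refine IsBigO.of_bound (κ ^ n) (Eventually.of_forall fun w => ?_)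
    simp only [Function.comp, norm_mul, norm_pow, mul_pow]
    rw [Real.norm_of_nonneg hκ0.le, ← pow_mul, two_mul]
  refine (h.trans_isBigO hO).congr' ?_ EventuallyEq.rfl
  filter_upwards [self_mem_nhdsWithin] with w hw
  have hw' : (0 : ℝ) < w := hw
  rw [tricomiResponse_eq (by omega) s hw', EhatFormula_eq hn s hs', hhalf]
  simp only [map_mul, map_add, hcomp, Polynomial.aeval_C, Complex.coe_algebraMap, Function.comp,
    ← hκ]
  have hres : -((((n + n : ℕ) : ℂ) - 1) * (w : ℂ) ^ 2 * tensorModeSlope (n + n) Λ s w)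
      / tensorMode (n + n) Λ s w
      = -2 * (((κ * w ^ 2 : ℝ) : ℂ) * (-momentumParam (n + n) Λ s *
        tricomiU (momentumParam (n + n) Λ s + 1) (1 - n + 1) (κ * w ^ 2))
          / tricomiU (momentumParam (n + n) Λ s) (1 - n) (κ * w ^ 2)) := by
    unfold tensorModeSlope tensorMode
    rw [hhalf', ← hκ, hκ]
    push_cast
    ring
  have hsum : ∑ k ∈ Finset.range (n + 1),
      Polynomial.aeval (momentumParam (n + n) Λ s) (q k) * ((κ * w ^ 2 : ℝ) : ℂ) ^ k
      = ∑ k ∈ Finset.Ico 1 n,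
        Polynomial.aeval (momentumParam (n + n) Λ s) (q k) * ((κ * w ^ 2 : ℝ) : ℂ) ^ k
        + Polynomial.aeval (momentumParam (n + n) Λ s) (q n) * ((κ * w ^ 2 : ℝ) : ℂ) ^ n := by
    rw [Finset.sum_range_succ, Finset.range_eq_Ico, Finset.sum_eq_sum_Ico_succ_bot (by omega), hq0]
    simp
  have hsum2 : ∑ k ∈ Finset.Ico 1 n, ((-2 : ℝ) : ℂ) * ((κ ^ k : ℝ) : ℂ) *
      Polynomial.aeval (momentumParam (n + n) Λ s) (q k) * (w : ℂ) ^ (2 * k)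
      = -2 * ∑ k ∈ Finset.Ico 1 n,
        Polynomial.aeval (momentumParam (n + n) Λ s) (q k) * ((κ * w ^ 2 : ℝ) : ℂ) ^ k := by
    rw [Finset.mul_sum]
    refine Finset.sum_congr rfl fun k _ => ?_
    push_cast
    ring
  have hlog : Real.log (κ * w ^ 2) = Real.log κ + Real.log (w ^ 2) :=
    Real.log_mul hκ0.ne' (by positivity)
  rw [hres, hsum, hsum2, hlog, hΓ]
  have hG : (Real.Gamma n : ℂ) ≠ 0 := by
    exact_mod_cast (Real.Gamma_pos_of_pos (by exact_mod_cast hn)).ne'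
  have hfac : responseFactor n = -2 * κ ^ n * n / Real.Gamma n := rfl
  rw [hfac]
  push_cast
  have hpow : (w : ℂ) ^ (n + n) = ((w : ℂ) ^ 2) ^ n := by rw [← pow_mul, two_mul]
  rw [hpow]
  field_simp
  ring

end Even

/-! ### Poles of the digamma function and of the renormalized response -/

lemma eventually_Gamma_ne_zero (z : ℂ) : ∀ᶠ y in 𝓝[≠] z, Complex.Gamma y ≠ 0 := by
  have h1 : meromorphicOrderAt Complex.Gamma 1 ≠ ⊤ := by
    rw [meromorphicOrderAt_ne_top_iff_eventually_ne_zero (Meromorphic.Gamma 1)]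
    have := Complex.continuousAt_Gamma_one.eventually_ne (by simp : Complex.Gamma 1 ≠ 0)
    exact this.filter_mono nhdsWithin_le_nhds
  exact (meromorphicOrderAt_ne_top_iff_eventually_ne_zero (Meromorphic.Gamma z)).1
    (MeromorphicOn.meromorphicOrderAt_ne_top_of_isPreconnected
      (U := univ) (fun y _ => Meromorphic.Gamma y) isPreconnected_univ (mem_univ 1) (mem_univ z) h1)

lemma meromorphicOrderAt_digamma_neg_natCast (m : ℕ) :
    meromorphicOrderAt Complex.digamma (-m) = -1 := by
  rw [Complex.digamma_def]
  refine meromorphicOrderAt_logDeriv_eq_neg_one (Meromorphic.Gamma _) ?_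
    ((meromorphicOrderAt_ne_top_iff_eventually_ne_zero (Meromorphic.Gamma _)).2
      (eventually_Gamma_ne_zero _))
  -- `1 / Γ` vanishes at `-m`
  have h : Tendsto (Complex.Gamma⁻¹) (𝓝[≠] (-m : ℂ)) (𝓝 0) := by
    have := (Complex.differentiable_one_div_Gamma (-m : ℂ)).continuousAt.tendsto
    rw [Complex.Gamma_neg_nat_eq_zero, inv_zero] at this
    exact this.mono_left nhdsWithin_le_nhds
  have h2 := (tendsto_zero_iff_meromorphicOrderAt_pos (Meromorphic.Gamma _).inv).1 h
  rw [meromorphicOrderAt_inv] at h2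
  intro h0
  simp [h0] at h2

lemma meromorphicOrderAt_digamma_nonneg {z : ℂ} (hz : ∀ m : ℕ, z ≠ -m) :
    0 ≤ meromorphicOrderAt Complex.digamma z := by
  have h1 : AnalyticAt ℂ Complex.Gamma z := by
    have := ((Complex.analyticOnNhd_univ_iff_differentiable.2 Complex.differentiable_one_div_Gamma) z
      (mem_univ z)).inv (inv_ne_zero (Complex.Gamma_ne_zero hz))
    convert! this using 1
    ext y
    simp
  exact (h1.deriv.div h1 (Complex.Gamma_ne_zero hz)).meromorphicOrderAt_nonneg

section Poles

variable {n : ℕ} {Λ : ℝ}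

lemma analyticAt_momentumParam (d : ℕ) (Λ : ℝ) (c s : ℂ) :
    AnalyticAt ℂ (fun s => momentumParam d Λ s + c) s := by
  unfold momentumParam
  simp only [div_eq_mul_inv]
  fun_prop

lemma analyticAt_aeval_momentumParam (d : ℕ) (Λ : ℝ) (p : Polynomial ℝ) (s : ℂ) :
    AnalyticAt ℂ (fun s => Polynomial.aeval (momentumParam d Λ s) p) s := by
  have h := analyticAt_momentumParam d Λ 0 s
  simp only [add_zero] at h
  exact h.aeval_polynomial p

lemma meromorphic_EhatFormula (d : ℕ) (Λ : ℝ) : Meromorphic (EhatFormula d Λ) := by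
  intro s
  have hg : ∀ c, AnalyticAt ℂ (fun s => c + momentumParam d Λ s) s := fun c => by
    simpa [add_comm] using analyticAt_momentumParam d Λ c s
  have h0 : AnalyticAt ℂ (fun s => momentumParam d Λ s) s := by
    simpa using analyticAt_momentumParam d Λ 0 s
  have m1 := (Meromorphic.Gamma _).comp_analyticAt (hg ((d : ℂ) / 2))
  have m2 := (Meromorphic.Gamma _).comp_analyticAt h0
  have m3 := (Complex.meromorphic_digamma _).comp_analyticAt (hg ((d : ℂ) / 2))
  exact (((MeromorphicAt.const _ s).mul m1).div ((MeromorphicAt.const _ s).mul m2)).mul m3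

lemma deriv_momentumParam_add_ne_zero (hΛ : 0 < Λ) (c s : ℂ) :
    deriv (fun s => momentumParam (n + n) Λ s + c) s ≠ 0 := by
  have h1 : (((n + n : ℕ) : ℂ) - 1) ≠ 0 := by
    rw [sub_ne_zero]; norm_cast; omega
  have h2 : (Λ : ℂ) ≠ 0 := by exact_mod_cast hΛ.ne'
  have h3 := mul_ne_zero (mul_ne_zero (two_ne_zero (α := ℂ)) h1) (pow_ne_zero 2 h2)
  have h : HasDerivAt (fun s => momentumParam (n + n) Λ s + c)
      (1 / (2 * (((n + n : ℕ) : ℂ) - 1) * (Λ : ℂ) ^ 2)) s :=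
    ((hasDerivAt_id s).div_const _).add_const c
  rw [h.deriv]
  exact one_div_ne_zero h3

/-- Off the isolated poles of `Γ(a + n)`, `Ê` is a polynomial times `ψ(a + n)`. -/
lemma EhatFormula_eventuallyEq (hn : 1 ≤ n) (hΛ : 0 < Λ) (s : ℂ) :
    EhatFormula (n + n) Λ =ᶠ[𝓝[≠] s]
      (fun s => responseFactor n * Polynomial.aeval (momentumParam (n + n) Λ s) (logCoeff n)) *
        (Complex.digamma ∘ fun s => momentumParam (n + n) Λ s + n) := by
  have hg := analyticAt_momentumParam (n + n) Λ n s
  have ht : Tendsto (fun s => momentumParam (n + n) Λ s + n) (𝓝[≠] s)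
      (𝓝[≠] (momentumParam (n + n) Λ s + n)) :=
    hg.differentiableAt.hasDerivAt.tendsto_nhdsNE (deriv_momentumParam_add_ne_zero hΛ n s)
  filter_upwards [ht.eventually (eventually_Gamma_ne_zero _)] with y hy
  exact EhatFormula_eq hn y fun m hm => hy (by rw [hm, Complex.Gamma_neg_nat_eq_zero])

lemma analyticAt_EhatFactor (s : ℂ) : AnalyticAt ℂ
    (fun s => responseFactor n * Polynomial.aeval (momentumParam (n + n) Λ s) (logCoeff n)) s :=
  analyticAt_const.mul (analyticAt_aeval_momentumParam _ _ _ s)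

lemma meromorphicOrderAt_EhatFormula_nonneg (hn : 1 ≤ n) (hΛ : 0 < Λ) {s : ℂ}
    (hs : s ∉ linearSpectrum (n + n) Λ) : 0 ≤ meromorphicOrderAt (EhatFormula (n + n) Λ) s := by
  have hg := analyticAt_momentumParam (n + n) Λ n s
  rw [meromorphicOrderAt_congr (EhatFormula_eventuallyEq hn hΛ s),
    meromorphicOrderAt_mul (analyticAt_EhatFactor s).meromorphicAt
      ((Complex.meromorphic_digamma _).comp_analyticAt hg),
    meromorphicOrderAt_comp_of_deriv_ne_zero hg (deriv_momentumParam_add_ne_zero hΛ n s)]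
  exact add_nonneg (analyticAt_EhatFactor s).meromorphicOrderAt_nonneg
    (meromorphicOrderAt_digamma_nonneg ((momentumParam_add_ne hΛ).1 hs))

lemma meromorphicOrderAt_EhatFormula (hn : 1 ≤ n) (hΛ : 0 < Λ) {s : ℂ}
    (hs : s ∈ linearSpectrum (n + n) Λ) : meromorphicOrderAt (EhatFormula (n + n) Λ) s = -1 := by
  have hg := analyticAt_momentumParam (n + n) Λ n s
  have hs' : ∃ m : ℕ, momentumParam (n + n) Λ s + n = -m := by
    by_contra! h
    exact (momentumParam_add_ne hΛ).2 h hs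
  obtain ⟨m, hm⟩ := hs'
  have hfac : responseFactor n * Polynomial.aeval (momentumParam (n + n) Λ s) (logCoeff n)
      ≠ (0 : ℂ) := by
    have hnR : (1 : ℝ) ≤ n := by exact_mod_cast hn
    have h1 : responseFactor n ≠ 0 := by
      unfold responseFactor
      have h3 : 0 < (((n + n : ℕ) : ℝ) - 1) / 2 := by push_cast; linarith
      have h4 := Real.Gamma_pos_of_pos (by linarith : (0 : ℝ) < n)
      have h5 := pow_pos h3 n
      have h6 : (0 : ℝ) < n := by linarith
      exact div_ne_zero (mul_ne_zero (mul_ne_zero (by norm_num) h5.ne') h6.ne') h4.ne'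
    refine mul_ne_zero (by exact_mod_cast h1) ?_
    rw [eq_sub_of_add_eq hm, logCoeff, map_mul, Polynomial.aeval_C]
    refine mul_ne_zero ?_ ?_
    · rw [Complex.coe_algebraMap]
      have : ((-1 : ℝ) ^ (n + 1) / (n.factorial : ℝ)) ≠ 0 :=
        div_ne_zero (pow_ne_zero _ (by norm_num)) (by exact_mod_cast n.factorial_ne_zero)
      exact_mod_cast this
    · rw [Polynomial.aeval_def, Polynomial.eval₂_eq_eval_map, ascPochhammer_map, Ne,
        ascPochhammer_eval_eq_zero_iff]
      push Not
      intro k hk h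
      have h' : (m : ℂ) + n = k := by linear_combination -h
      norm_cast at h'
      omega
  rw [meromorphicOrderAt_congr (EhatFormula_eventuallyEq hn hΛ s), mul_comm,
    meromorphicOrderAt_mul ((Complex.meromorphic_digamma _).comp_analyticAt hg)
      (analyticAt_EhatFactor s).meromorphicAt,
    meromorphicOrderAt_comp_of_deriv_ne_zero hg (deriv_momentumParam_add_ne_zero hΛ n s), hm,
    meromorphicOrderAt_digamma_neg_natCast]
  have h0 : meromorphicOrderAt (fun s => responseFactor n *
      Polynomial.aeval (momentumParam (n + n) Λ s) (logCoeff n)) s = 0 :=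
    (tendsto_ne_zero_iff_meromorphicOrderAt_eq_zero (analyticAt_EhatFactor s).meromorphicAt).1
      ⟨_, hfac, (analyticAt_EhatFactor s).continuousAt.tendsto.mono_left nhdsWithin_le_nhds⟩
  rw [h0, add_zero]

end Poles

/-! ### Uniqueness of the renormalized response up to contact terms -/

lemma tendsto_ofReal_log_inv_nhdsGT_zero :
    Tendsto (fun x : ℝ => (Real.log x : ℂ)⁻¹) (𝓝[>] 0) (𝓝 0) := by
  have h := (Complex.continuous_ofReal.tendsto 0).comp
    (tendsto_inv_atBot_zero.comp Real.tendsto_log_nhdsGT_zero)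
  rw [Complex.ofReal_zero] at h
  exact h.congr fun x => by simp

/-- The constant next to the logarithm in an expansion is determined by the function. -/
lemma eq_zero_of_isLittleO_logPoly {n : ℕ} {c : ℕ → ℂ} {l g : ℂ}
    (h : (fun x : ℝ => ∑ k ∈ Finset.range n, c k * (x : ℂ) ^ k
      + (l * Real.log x + g) * (x : ℂ) ^ n) =o[𝓝[>] 0] fun x : ℝ => x ^ n) : g = 0 := by
  induction n generalizing c with
  | zero =>
    simp only [Finset.range_zero, Finset.sum_empty, zero_add, pow_zero, mul_one] at h
    rw [isLittleO_one_iff] at h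
    have hl : l = 0 := by
      have h1 := (h.mul tendsto_ofReal_log_inv_nhdsGT_zero).sub
        (tendsto_ofReal_log_inv_nhdsGT_zero.const_mul g)
      simp only [mul_zero, sub_zero] at h1
      refine tendsto_nhds_unique (tendsto_const_nhds.congr' ?_) h1
      filter_upwards [Ioo_mem_nhdsGT one_pos] with x hx
      have : (Real.log x : ℂ) ≠ 0 := by exact_mod_cast (Real.log_neg hx.1 hx.2).ne
      field_simp
      ring
    simp only [hl, zero_mul, zero_add] at h
    exact tendsto_nhds_unique tendsto_const_nhds h
  | succ n ih =>
    have hc : c 0 = 0 := by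
      have h1 := (tendsto_sum_range_mul_pow n c).add
        (((tendsto_pow_succ_mul_log_add n 0).const_mul l).add
          ((tendsto_ofReal_nhdsGT_zero.pow (n + 1)).const_mul g))
      have h2 : Tendsto (fun x : ℝ => x ^ (n + 1)) (𝓝[>] 0) (𝓝 0) := by
        have : ContinuousAt (fun x : ℝ => x ^ (n + 1)) 0 := by fun_prop
        simpa using this.tendsto.mono_left (nhdsWithin_le_nhds (s := Ioi 0))
      have h3 := h.trans_tendsto h2
      simp only [ne_eq, Nat.succ_ne_zero, not_false_eq_true, zero_pow, mul_zero, add_zero] at h1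
      refine tendsto_nhds_unique h1 (h3.congr fun x => ?_)
      ring
    refine ih (c := fun k => c (k + 1)) ?_
    rw [isLittleO_pow_iff_tendsto] at h ⊢
    refine h.congr' ?_
    filter_upwards [self_mem_nhdsWithin] with x hx
    have hx' : (x : ℂ) ≠ 0 := by exact_mod_cast (ne_of_gt hx)
    have hxn : (x : ℂ) ^ n ≠ 0 := pow_ne_zero _ hx'
    have hs : ∑ k ∈ Finset.range n, c (k + 1) * (x : ℂ) ^ (k + 1)
        = x * ∑ k ∈ Finset.range n, c (k + 1) * (x : ℂ) ^ k := by
      rw [Finset.mul_sum]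
      exact Finset.sum_congr rfl fun k _ => by ring
    rw [Finset.sum_range_succ', hs, hc, pow_succ]
    field_simp
    ring

/-- Two renormalized parts of the same family differ by a polynomial. -/
lemma exists_polynomial_eq_sub {n : ℕ} (hn : 1 ≤ n) {S : Set ℂ} {R : ℂ → ℝ → ℂ} {G₁ G₂ : ℂ → ℂ}
    (h₁ : IsNonanalyticRenormalizedPart (n + n) S R G₁)
    (h₂ : IsNonanalyticRenormalizedPart (n + n) S R G₂) :
    ∃ Q : Polynomial ℝ, ∀ s ∈ S, G₁ s = G₂ s + Polynomial.aeval s Q := by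
  obtain ⟨c₁, l₁, Q₁, h₁⟩ := h₁
  obtain ⟨c₂, l₂, Q₂, h₂⟩ := h₂
  have hhalf : (n + n) / 2 = n := by omega
  refine ⟨Q₂ - Q₁, fun s hs => ?_⟩
  have h := (h₂ s hs).sub (h₁ s hs)
  have hsqrt : Tendsto (fun x : ℝ => √x) (𝓝[>] 0) (𝓝[>] 0) := by
    rw [tendsto_nhdsWithin_iff]
    refine ⟨?_, by filter_upwards [self_mem_nhdsWithin] with x hx using Real.sqrt_pos.2 hx⟩
    have := Real.continuous_sqrt.tendsto 0
    rw [Real.sqrt_zero] at this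
    exact this.mono_left nhdsWithin_le_nhds
  have h3 := h.comp_tendsto hsqrt
  have hpow : ∀ x : ℝ, 0 < x → ∀ k : ℕ, ((√x : ℝ) : ℂ) ^ (2 * k) = (x : ℂ) ^ k := by
    intro x hx k
    rw [pow_mul, ← Complex.ofReal_pow, Real.sq_sqrt hx.le]
  have key : (fun x : ℝ => ∑ k ∈ Finset.range n,
      (if k = 0 then 0 else Polynomial.aeval s (c₁ k) - Polynomial.aeval s (c₂ k)) * (x : ℂ) ^ k
      + ((Polynomial.aeval s l₁ - Polynomial.aeval s l₂) * Real.log x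
        + (G₁ s + Polynomial.aeval s Q₁ - (G₂ s + Polynomial.aeval s Q₂))) * (x : ℂ) ^ n)
      =o[𝓝[>] 0] fun x : ℝ => x ^ n := by
    refine h3.congr' ?_ ?_
    · filter_upwards [self_mem_nhdsWithin] with x hx
      have hx' : (0 : ℝ) < x := hx
      have hn2 : ((√x : ℝ) : ℂ) ^ (n + n) = (x : ℂ) ^ n := by rw [← two_mul, hpow x hx']
      simp only [Function.comp, hhalf, hpow x hx', hn2, Real.sq_sqrt hx'.le]
      have hsum : ∑ k ∈ Finset.range n, (if k = 0 then 0 else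
          Polynomial.aeval s (c₁ k) - Polynomial.aeval s (c₂ k)) * (x : ℂ) ^ k
          = ∑ k ∈ Finset.Ico 1 n, Polynomial.aeval s (c₁ k) * (x : ℂ) ^ k
            - ∑ k ∈ Finset.Ico 1 n, Polynomial.aeval s (c₂ k) * (x : ℂ) ^ k := by
        rw [Finset.range_eq_Ico, Finset.sum_eq_sum_Ico_succ_bot (by omega),
          ← Finset.sum_sub_distrib]
        simp only [if_true, zero_mul, zero_add]
        refine Finset.sum_congr rfl fun k hk => ?_
        rw [if_neg (by have := (Finset.mem_Ico.1 hk).1; omega)]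
        ring
      rw [hsum]
      ring
    · filter_upwards [self_mem_nhdsWithin] with x hx
      have hx' : (0 : ℝ) < x := hx
      simp only [Function.comp]
      rw [← two_mul, pow_mul, Real.sq_sqrt hx'.le]
  have h0 := eq_zero_of_isLittleO_logPoly key
  rw [map_sub]
  linear_combination h0

/-- Two meromorphic functions on `ℂ` that agree on the nonnegative reals agree on a punctured
neighbourhood of each point. -/
lemma Meromorphic.eventuallyEq_of_eqOn_nonneg {f g : ℂ → ℂ} (hf : Meromorphic f)
    (hg : Meromorphic g) (h : ∀ x : ℝ, 0 ≤ x → f x = g x) (s : ℂ) : f =ᶠ[𝓝[≠] s] g := by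
  have hfg : MeromorphicOn (f - g) univ := fun z _ => (hf z).sub (hg z)
  have h1 : meromorphicOrderAt (f - g) 1 = ⊤ := by
    by_contra hne
    have hev := (meromorphicOrderAt_ne_top_iff_eventually_ne_zero (hfg 1 (mem_univ _))).1 hne
    have ht : Tendsto (fun x : ℝ => (x : ℂ)) (𝓝[≠] 1) (𝓝[≠] 1) := by
      rw [tendsto_nhdsWithin_iff]
      constructor
      · have := Complex.continuous_ofReal.tendsto 1
        rw [Complex.ofReal_one] at this
        exact this.mono_left nhdsWithin_le_nhds
      · filter_upwards [self_mem_nhdsWithin] with x hx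
        simpa using hx
    have hge : ∀ᶠ x : ℝ in 𝓝[≠] 1, 0 ≤ x := mem_nhdsWithin_of_mem_nhds (Ici_mem_nhds one_pos)
    obtain ⟨x, hx1, hx2⟩ := ((ht.eventually hev).and hge).exists
    exact hx1 (by simp [h x hx2])
  have h2 : meromorphicOrderAt (f - g) s = ⊤ := by
    by_contra hne
    exact hfg.meromorphicOrderAt_ne_top_of_isPreconnected isPreconnected_univ (mem_univ s)
      (mem_univ 1) hne h1
  filter_upwards [meromorphicOrderAt_eq_top_iff.1 h2] with y hy
  exact sub_eq_zero.1 hy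

lemma meromorphicOrderAt_of_isNonanalyticRenormalizedPart {n : ℕ} {Λ : ℝ} (hn : 1 ≤ n) (hΛ : 0 < Λ)
    {G : ℂ → ℂ} (hG : Meromorphic G)
    (h : IsNonanalyticRenormalizedPart (n + n) {s | ∃ psq : ℝ, 0 ≤ psq ∧ s = psq}
      (tricomiResponse (n + n) Λ) G) :
    (∀ s ∈ linearSpectrum (n + n) Λ, meromorphicOrderAt G s = -1) ∧
      ∀ s ∉ linearSpectrum (n + n) Λ, 0 ≤ meromorphicOrderAt G s := by
  have hsub : {s : ℂ | ∃ psq : ℝ, 0 ≤ psq ∧ s = psq} ⊆ (linearSpectrum (n + n) Λ)ᶜ := by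
    rintro _ ⟨p, hp, rfl⟩
    refine (momentumParam_add_ne hΛ).2 fun m hm => ?_
    obtain ⟨a, ha, ha'⟩ := momentumParam_ofReal (d := n + n) (by omega) hΛ hp
    rw [ha'] at hm
    have h1 : a + n = -m := by exact_mod_cast hm
    have h2 : (1 : ℝ) ≤ n := by exact_mod_cast hn
    have h3 : (0 : ℝ) ≤ m := m.cast_nonneg
    linarith
  have hE : IsNonanalyticRenormalizedPart (n + n) {s | ∃ psq : ℝ, 0 ≤ psq ∧ s = psq}
      (tricomiResponse (n + n) Λ) (EhatFormula (n + n) Λ) := by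
    obtain ⟨c, l, Q, hc⟩ := isNonanalyticRenormalizedPart_EhatFormula hn hΛ
    exact ⟨c, l, Q, fun s hs => hc s (hsub hs)⟩
  obtain ⟨Q, hQ⟩ := exists_polynomial_eq_sub hn h hE
  have hQa : ∀ s, AnalyticAt ℂ (fun s : ℂ => Polynomial.aeval s Q) s := fun s =>
    analyticAt_id.aeval_polynomial Q
  have hEm := meromorphic_EhatFormula (n + n) Λ
  have hev := hG.eventuallyEq_of_eqOn_nonneg
    (g := EhatFormula (n + n) Λ + fun s : ℂ => Polynomial.aeval s Q)
    (fun s => (hEm s).add (hQa s).meromorphicAt) fun x hx => hQ x ⟨x, hx, rfl⟩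
  constructor
  · intro s hs
    have h1 := meromorphicOrderAt_EhatFormula hn hΛ hs
    rw [meromorphicOrderAt_congr (hev s), meromorphicOrderAt_add_eq_left_of_lt
      (hQa s).meromorphicAt, h1]
    rw [h1]
    exact lt_of_lt_of_le (by decide) (hQa s).meromorphicOrderAt_nonneg
  · intro s hs
    rw [meromorphicOrderAt_congr (hev s)]
    exact (le_min (meromorphicOrderAt_EhatFormula_nonneg hn hΛ hs)
      (hQa s).meromorphicOrderAt_nonneg).trans (meromorphicOrderAt_add (hEm s) (hQa s).meromorphicAt)

/-! ### The infrared regular response and its linear spectrum -/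

theorem mainTheorem3 (d : ℕ) (hd : 2 ≤ d) (Λ L : ℝ) (hΛ : 0 < Λ) (hL : 0 < L) :
    -- the infrared regular tensor response function exists, is unique, and is `-w ∂_w U / U`
    (∀ psq : ℝ, 0 ≤ psq → ∃ E : ℝ → ℝ,
      IsTensorResponse d (warpFactor Λ L) psq E ∧
      IsIRRegular (warpFactor Λ L) E ∧
      (∀ F : ℝ → ℝ, IsTensorResponse d (warpFactor Λ L) psq F →
        IsIRRegular (warpFactor Λ L) F → EqOn F E (Ioi 0)) ∧
      ∀ w : ℝ, 0 < w → tensorMode d Λ psq w ≠ 0 ∧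
        (dimlessResponse Λ L E w : ℂ) = tricomiResponse d Λ psq w) ∧
    -- for every squared momentum, `-w ∂_w U / U` solves the dimensionless Riccati equation
    (∀ (s : ℂ) (w : ℝ), 0 < w →
      DifferentiableAt ℝ (tensorMode d Λ s) w ∧
      (tensorMode d Λ s w ≠ 0 → ∃ E' : ℂ, HasDerivAt (tricomiResponse d Λ s) E' w ∧
        w * E' - tricomiResponse d Λ s w ^ 2
          - ((d : ℂ) + ((d : ℂ) - 1) * (w : ℂ) ^ 2) * tricomiResponse d Λ s w
          + s / (Λ : ℂ) ^ 2 * (w : ℂ) ^ 2 = 0)) ∧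
    -- the non-analytic renormalized part for even `d`, and the linear spectrum
    (Even d →
      (∀ s ∉ linearSpectrum d Λ, ∀ᶠ w in 𝓝[>] (0 : ℝ), tensorMode d Λ s w ≠ 0) ∧
      IsNonanalyticRenormalizedPart d (linearSpectrum d Λ)ᶜ (tricomiResponse d Λ)
        (EhatFormula d Λ) ∧
      Meromorphic (EhatFormula d Λ) ∧
      ∀ G : ℂ → ℂ, Meromorphic G →
        IsNonanalyticRenormalizedPart d {s | ∃ psq : ℝ, 0 ≤ psq ∧ s = psq}
          (tricomiResponse d Λ) G →
        poleSpectrum G = linearSpectrum d Λ ∧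
        ∀ s ∈ linearSpectrum d Λ, meromorphicOrderAt G s = -1) := by
  refine ⟨fun psq hp => ?_, fun s w hw => ?_, ?_⟩
  · refine ⟨tricomiTensorResponse d Λ L psq, isTensorResponse_tricomiTensorResponse hd hΛ hL hp,
      isIRRegular_tricomiTensorResponse hd hΛ hL hp, fun F hF hreg => ?_, fun w hw =>
        ⟨tensorMode_ne_zero hd hΛ hp hw, dimlessResponse_tricomiTensorResponse hd hΛ hL hp hw⟩⟩
    exact IsTensorResponse.eqOn (by omega)
      (fun z hz => (hasDerivAt_warpFactor Λ hL hz).differentiableAt) (antitoneOn_warpFactor Λ hL) hp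
      hF (isTensorResponse_tricomiTensorResponse hd hΛ hL hp) hreg
      (isIRRegular_tricomiTensorResponse hd hΛ hL hp)
  · exact ⟨(hasDerivAt_tensorMode hd s hw).differentiableAt,
      fun h0 => tricomiResponse_riccati hd hΛ s hw h0⟩
  · rintro ⟨n, rfl⟩
    have hn : 1 ≤ n := by omega
    refine ⟨fun s hs => eventually_tensorMode_ne_zero hn hΛ hs,
      isNonanalyticRenormalizedPart_EhatFormula hn hΛ, meromorphic_EhatFormula _ _,
      fun G hG hR => ?_⟩
    obtain ⟨h1, h2⟩ := meromorphicOrderAt_of_isNonanalyticRenormalizedPart hn hΛ hG hR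
    refine ⟨Set.ext fun s => ⟨fun hs => ?_, fun hs => ?_⟩, h1⟩
    · by_contra hns
      exact absurd (h2 s hns) (not_le.2 hs)
    · change meromorphicOrderAt G s < 0
      rw [h1 s hs]
      decide
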